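/- Let $N$ be a simply connected Lie group whose Lie algebra $\mathfrak n$ is 2-step nilpotent, meaning $[\mathfrak n,\mathfrak n]\subseteq\mathfrak z$ where $\mathfrak z$ is the center of $\mathfrak n$. Let $\langle\,,\rangle$ be an inner product on $\mathfrak n$ (a nondegenerate symmetric bilinear form, not necessarily definite), and give $N$ the induced left-invariant pseudoriemannian metric tensor. Let $\Gamma$ be a lattice in $N$, i.e. a discrete subgroup such that $\Gamma\backslash N$ is compact, and give $\Gamma\backslash N$ the smooth structure and the metric tensor for which $p_N\colon N\to\Gamma\backslash N$ is a local diffeomorphism and a local isometry. Let $Z$ be the center of $N$; it acts on $\Gamma\backslash N$ by $z\cdot\Gamma n=\Gamma zn$. Let $p_B\colon\Gamma\backslash N\to T_B$ be the projection onto the orbit space of this action; this is the principal torus bundle underlying the generalized pseudoriemannian submersion $\Gamma\backslash N\to T_B$. Let $\log$ be the inverse of $\exp\colon\mathfrak n\to N$. Then $\log\Gamma\cap\mathfrak z=\{x\in\mathfrak z:\exp x\in\Gamma\}$ is a vector lattice in $\mathfrak z$ (a discrete additive subgroup that spans $\mathfrak z$). Let $T_{\mathfrak z}=\mathfrak z/(\log\Gamma\cap\mathfrak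 z)$ be the flat torus whose (possibly degenerate) metric tensor is induced by the constant tensor $\langle\,,\rangle|_{\mathfrak z}$. For every $b\in T_B$, the fiber $T_F=p_B^{-1}(b)$, with the (possibly degenerate) geometry induced from its embedding in $\Gamma\backslash N$, is isometric to $T_{\mathfrak z}$: there is a smooth embedding $f\colon T_{\mathfrak z}\to\Gamma\backslash N$ with image $p_B^{-1}(b)$ such that the pullback under $f$ of the metric tensor of $\Gamma\backslash N$ is the metric tensor of $T_{\mathfrak z}$. -/

import Mathlib

open scoped Manifold ContDiff

noncomputable section

namespace Nil

/-! ### The Lie algebra of `N`, its center, and the exponential map -/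

section LieGroup

variable (E : Type*) [NormedAddCommGroup E] [NormedSpace ℝ E] [FiniteDimensional ℝ E]
  (N : Type*) [TopologicalSpace N] [ChartedSpace E N] [Group N]

/-- The Lie algebra `𝔫` of `N`: the tangent space at `1` with the bracket of left-invariant
vector fields. -/
abbrev LieAlg : Type _ := GroupLieAlgebra 𝓘(ℝ, E) N

/-- `[𝔫, 𝔫] ⊆ 𝔷`, that is `[[x, y], w] = 0` for all `x, y, w ∈ 𝔫`. -/
def IsTwoStep : Prop := ∀ x y w : LieAlg E N, ⁅⁅x, y⁆, w⁆ = 0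

/-- The center `𝔷` of the Lie algebra `𝔫`. It is recorded as a subspace of the model space `E`, to
which the tangent space at `1` is definitionally equal; this makes `𝔷` a normed space. -/
def lieCenter [LieGroup 𝓘(ℝ, E) ∞ N] : Submodule ℝ E :=
  haveI : LieGroup 𝓘(ℝ, E) (minSmoothness ℝ 3) N := LieGroup.of_le (n := ∞) (by
    rw [minSmoothness_of_isRCLikeNormedField]
    exact WithTop.coe_le_coe.mpr le_top)
  haveI : CompleteSpace E := FiniteDimensional.complete ℝ E
  show Submodule ℝ (LieAlg E N) from (LieAlgebra.center ℝ (LieAlg E N)).toSubmodule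

variable {E N}

open Classical in
/-- The Lie group exponential: `exp x = c 1`, where `c : ℝ → N` is the integral curve through `1`
of the left-invariant vector field with value `x` at `1` (the one-parameter subgroup with initial
velocity `x`). -/
def lieExp (x : LieAlg E N) : N :=
  if h : ∃ c : ℝ → N, c 0 = 1 ∧
      IsMIntegralCurve (I := 𝓘(ℝ, E)) c (fun g => mulInvariantVectorField x g)
  then h.choose 1 else 1

end LieGroup

/-! ### Fields of symmetric bilinear forms, possibly degenerate -/

section Tensor

variable {F : Type*} [NormedAddCommGroup F] [NormedSpace ℝ F]
  {M : Type*} [TopologicalSpace M] [ChartedSpace F M]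
  {F' : Type*} [NormedAddCommGroup F'] [NormedSpace ℝ F']
  {M' : Type*} [TopologicalSpace M'] [ChartedSpace F' M']

/-- A field of bilinear forms on the tangent spaces of `M`. -/
abbrev BilinField (F : Type*) [NormedAddCommGroup F] [NormedSpace ℝ F]
    (M : Type*) [TopologicalSpace M] [ChartedSpace F M] : Type _ :=
  (p : M) → LinearMap.BilinForm ℝ (TangentSpace 𝓘(ℝ, F) p)

/-- The pullback `(f^* h)_p (X, Y) = h_{f p} (df_p X, df_p Y)`. -/
def pullbackField (f : M → M') (h : BilinField F' M') : BilinField F M := fun p =>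
  LinearMap.compl₁₂ (h (f p)) (mfderiv 𝓘(ℝ, F) 𝓘(ℝ, F') f p).toLinearMap
    (mfderiv 𝓘(ℝ, F) 𝓘(ℝ, F') f p).toLinearMap

/-- Given a surjection `π : M → M'` that is a local diffeomorphism and a field `g` on `M` that is
invariant under the deck transformations, the field on `M'` that makes `π` a local isometry: its
value at `q` is `g_p (dπ_p⁻¹ X, dπ_p⁻¹ Y)` for some (equivalently, any) `p` with `π p = q`. -/
def descendField (π : M → M') (hπ : Function.Surjective π) (g : BilinField F M) :
    BilinField F' M' := fun q =>
  let p : M := Function.surjInv hπ q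
  let L : TangentSpace 𝓘(ℝ, F') q →L[ℝ] TangentSpace 𝓘(ℝ, F) p :=
    (mfderiv 𝓘(ℝ, F) 𝓘(ℝ, F') π p).inverse
  LinearMap.compl₁₂ (g p) L.toLinearMap L.toLinearMap

/-- `f` is an isometry of `(M, g)` onto the subset `S` of `(M', h)`, where `S` carries the geometry
induced from `M'`: `f` is a smooth embedding with image `S` and `f^* h = g`. -/
structure IsIsometryOnto (g : BilinField F M) (h : BilinField F' M') (f : M → M')
    (S : Set M') : Prop where
  isSmoothEmbedding : Manifold.IsSmoothEmbedding 𝓘(ℝ, F) 𝓘(ℝ, F') ∞ f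
  range_eq : Set.range f = S
  isometric : pullbackField f h = g

end Tensor

/-! ### The flat torus `V / Λ` -/

section Torus

variable {V : Type*} [NormedAddCommGroup V]

/-- The quotient of the vector space `V` by the translations in the subgroup `Λ`. -/
abbrev Torus (Λ : AddSubgroup V) : Type _ := AddAction.orbitRel.Quotient Λ V

/-- The projection `V → V / Λ`. -/
def torusProj (Λ : AddSubgroup V) : V → Torus Λ := Quotient.mk _

theorem torusProj_surjective (Λ : AddSubgroup V) : Function.Surjective (torusProj Λ) :=
  Quotient.mk_surjective

/-- The manifold structure on `V / Λ` for discrete `Λ`, pushed forward along the covering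
`V → V / Λ`. -/
instance torusChartedSpace [NormedSpace ℝ V] [FiniteDimensional ℝ V] (Λ : AddSubgroup V) [DiscreteTopology Λ] :
    ChartedSpace V (Torus Λ) :=
  haveI : ProperSpace V := FiniteDimensional.proper ℝ V
  haveI : ProperlyDiscontinuousVAdd Λ V :=
    AddSubgroup.properlyDiscontinuousVAdd_of_tendsto_cofinite Λ
      (Λ.tendsto_coe_cofinite_of_discrete (isDiscrete_iff_discreteTopology.mpr inferInstance))
  AddAction.instChartedSpaceQuotient

/-- The metric tensor on `V / Λ` induced by the constant tensor `b` on `V`. -/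
def torusMetric [NormedSpace ℝ V] [FiniteDimensional ℝ V] (Λ : AddSubgroup V) [DiscreteTopology Λ]
    (b : LinearMap.BilinForm ℝ V) : BilinField V (Torus Λ) :=
  descendField (F := V) (M := V) (torusProj Λ) (torusProj_surjective Λ) (fun _ => b)

end Torus

/-! ### The nilmanifold `Γ \ N` and its projection to `T_B` -/

section Quotient

variable {N : Type*} [Group N]

/-- `Γ \ N`: the quotient of `N` by left translations by elements of `Γ`. -/
abbrev Nilmanifold (Γ : Subgroup N) : Type _ := MulAction.orbitRel.Quotient Γ N

/-- The projection `p_N : N → Γ \ N`. -/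
def nilProj (Γ : Subgroup N) : N → Nilmanifold Γ := Quotient.mk _

theorem nilProj_surjective (Γ : Subgroup N) : Function.Surjective (nilProj Γ) :=
  Quotient.mk_surjective

end Quotient

section Nilmanifold

variable {E : Type*} [NormedAddCommGroup E] [NormedSpace ℝ E]
  {N : Type*} [TopologicalSpace N] [ChartedSpace E N] [Group N]

/-- The left-invariant metric tensor on `N` with value `B` at `1`:
`g_p (X, Y) = B (d(L_{p⁻¹})_p X, d(L_{p⁻¹})_p Y)`. -/
def leftInvariantMetric (B : LinearMap.BilinForm ℝ (LieAlg E N)) : BilinField E N := fun p =>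
  let L : TangentSpace 𝓘(ℝ, E) p →L[ℝ] LieAlg E N :=
    mfderiv 𝓘(ℝ, E) 𝓘(ℝ, E) (fun n : N => p⁻¹ * n) p
  LinearMap.compl₁₂ B L.toLinearMap L.toLinearMap

/-- The manifold structure on `Γ \ N` for discrete `Γ`, pushed forward along the covering
`p_N : N → Γ \ N`. -/
instance nilChartedSpace [FiniteDimensional ℝ E] [LieGroup 𝓘(ℝ, E) ∞ N] [T2Space N]
    (Γ : Subgroup N) [DiscreteTopology Γ] : ChartedSpace E (Nilmanifold Γ) :=
  haveI : IsTopologicalGroup N := topologicalGroup_of_lieGroup 𝓘(ℝ, E) ∞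
  haveI : LocallyCompactSpace N := Manifold.locallyCompact_of_finiteDimensional 𝓘(ℝ, E)
  haveI : ProperlyDiscontinuousSMul Γ N :=
    Subgroup.properlyDiscontinuousSMul_of_tendsto_cofinite Γ
      (Γ.tendsto_coe_cofinite_of_discrete (isDiscrete_iff_discreteTopology.mpr inferInstance))
  MulAction.instChartedSpaceQuotient

/-- The metric tensor on `Γ \ N` for which `p_N` is a local isometry. -/
def nilMetric [FiniteDimensional ℝ E] [LieGroup 𝓘(ℝ, E) ∞ N] [T2Space N]
    (Γ : Subgroup N) [DiscreteTopology Γ] (B : LinearMap.BilinForm ℝ (LieAlg E N)) :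
    BilinField E (Nilmanifold Γ) :=
  descendField (nilProj Γ) (nilProj_surjective Γ) (leftInvariantMetric B)

/-- The action of the center `Z` of `N` on `Γ \ N` by `z • Γ n = Γ z n`. It factors through a free
action of the torus `(Γ ∩ Z) \ Z`, the structure group of the principal bundle `Γ \ N → T_B`. -/
instance centerAction (Γ : Subgroup N) : MulAction (Subgroup.center N) (Nilmanifold Γ) where
  smul z := Quotient.map (fun n : N => (z : N) * n) (by
    rintro a b ⟨γ, rfl⟩
    refine ⟨γ, ?_⟩
    change (γ : N) * ((z : N) * b) = (z : N) * ((γ : N) * b)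
    rw [← mul_assoc, ← mul_assoc, Subgroup.mem_center_iff.mp z.2 γ])
  one_smul q := by
    induction q using Quotient.inductionOn with
    | h n => exact congrArg (Quotient.mk _) (one_mul n)
  mul_smul z w q := by
    induction q using Quotient.inductionOn with
    | h n => exact congrArg (Quotient.mk _) (mul_assoc (z : N) (w : N) n)

/-- The base `T_B` of the principal torus bundle `Γ \ N → T_B`: the orbit space of the action of
the center. -/
abbrev TB (Γ : Subgroup N) : Type _ :=
  MulAction.orbitRel.Quotient (Subgroup.center N) (Nilmanifold Γ)

/-- The projection `p_B : Γ \ N → T_B`. -/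
def projB (Γ : Subgroup N) : Nilmanifold Γ → TB Γ := Quotient.mk _

/-- The restriction of the inner product on `𝔫` to the center `𝔷`; it may be degenerate. -/
def centerForm [FiniteDimensional ℝ E] [LieGroup 𝓘(ℝ, E) ∞ N]
    (B : LinearMap.BilinForm ℝ (LieAlg E N)) : LinearMap.BilinForm ℝ (lieCenter E N) :=
  LinearMap.BilinForm.restrict (show LinearMap.BilinForm ℝ E from B) (lieCenter E N)

/-- The set `log Γ ∩ 𝔷 = {x ∈ 𝔷 | exp x ∈ Γ}`. -/
def logCenter [FiniteDimensional ℝ E] [LieGroup 𝓘(ℝ, E) ∞ N] (Γ : Subgroup N) :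
    Set (lieCenter E N) :=
  {x | lieExp (show LieAlg E N from (x : E)) ∈ Γ}

end Nilmanifold

end Nil

end

/-! The isometry is explicit. For `n : N` above `b`, take `v ↦ Γ n exp v` on `𝔷`. Because `exp` is
additive on `𝔷`, `(n exp v)⁻¹ (n exp w) = exp (w - v)`, and the derivative of this at `w = v` is the
inclusion `𝔷 ⊆ 𝔫`. A left-invariant metric therefore pulls back along `v ↦ n exp v` to the constant
tensor `⟨ , ⟩|𝔷`, whatever `n` is (`mfderiv_mul_left_comp_centerOrbit`,
`pullbackField_centerOrbit`). Since `exp v` is central, `Γ n exp v = Γ n exp w` exactly when `v - w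
∈ log Γ ∩ 𝔷`, so the map descends to an injective immersion `fiberMap` of the torus. Its image is a
full orbit of the center because `exp 𝔷 = Z`. The torus is compact and `Γ \ N` is Hausdorff, so the
immersion is an embedding.

Two facts carry the weight. The first is the structure of `exp` in the 2-step case. The derivative
of `Ad` along a one-parameter subgroup is the bracket (`hasDerivAt_Ad_expMap`), whence `Ad (exp x) y
= y + [x, y]`. Since a one-parameter subgroup is determined by its velocity, this yields the product
formula `expMap_mul`, then surjectivity of `exp` and the equality of `Z` with `exp 𝔷`.

The second is Malcev's theorem that `log Γ ∩ 𝔷` spans `𝔷` (`lieCenter_le_spanLogCenter`). A linear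
functional vanishing on brackets and on `log Γ` induces a continuous character of `N` trivial on
`Γ`; it is bounded by compactness, hence zero. So brackets and `log Γ` together span `𝔫`.
Consequently all brackets lie in the span `S` of `log Γ ∩ 𝔷`, and `𝔷` is the kernel of the map `R`
that brackets with finitely many elements of `log Γ`. The image of `log Γ` under `R` is a discrete
group; lifts of a `ℤ`-basis of it span `𝔫` together with `S`, and an element of `𝔷 = ker R` has no
component along these lifts.

Tensors and smooth maps on the two quotients are handled by pulling back along the coverings, which
are local diffeomorphisms with smooth deck transformations. -/

noncomputable section

set_option linter.unusedSectionVars false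

namespace Nil

/-! ### Second derivatives of a local group law -/

section Calculus

open Filter Topology

variable {E : Type*} [NormedAddCommGroup E] [NormedSpace ℝ E]

/-- The derivative of the left-invariant field of a local group law is a second derivative. -/
theorem hasFDerivAt_fderiv_apply_left {m : E × E → E} {e : E} (hm : ContDiffAt ℝ 2 m (e, e))
    (w : E × E) :
    HasFDerivAt (fun x => fderiv ℝ m (x, e) w)
      (((fderiv ℝ (fderiv ℝ m) (e, e)).comp (ContinuousLinearMap.inl ℝ E E)).flip w) e := by
  have h1 : HasFDerivAt (fderiv ℝ m) (fderiv ℝ (fderiv ℝ m) (e, e)) (e, e) :=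
    ((hm.fderiv_right (m := 1) (by norm_num)).differentiableAt (by norm_num)).hasFDerivAt
  have h2 := HasFDerivAt.comp (f := fun x => (x, e)) e h1 (hasFDerivAt_prodMk_left (𝕜 := ℝ) e e)
  exact (h2.clm_apply (hasFDerivAt_const w e)).congr_fderiv (by ext; simp)

/-- In a local group, the derivative of the adjoint action is the bracket of left-invariant
fields, both expressed through the second derivative of the group law. -/
theorem fderiv_conj_eq {m c : E × E → E} {e : E} (hm : ContDiffAt ℝ 2 m (e, e))
    (hc : ContDiffAt ℝ 2 c (e, e)) (hmc : ∀ᶠ p in 𝓝 (e, e), m p = m (c p, p.1))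
    (hce : ∀ᶠ x in 𝓝 e, c (x, e) = e) (hm1 : ∀ᶠ y in 𝓝 e, m (e, y) = y)
    (hm2 : ∀ᶠ x in 𝓝 e, m (x, e) = x) (X Y : E) :
    fderiv ℝ (fun x => fderiv ℝ c (x, e) (0, Y)) e X =
      fderiv ℝ (fun x => fderiv ℝ m (x, e) (0, Y)) e X -
        fderiv ℝ (fun x => fderiv ℝ m (x, e) (0, X)) e Y := by
  have hcee : c (e, e) = e := hce.self_of_nhds
  have dm : HasFDerivAt m (fderiv ℝ m (e, e)) (e, e) :=
    (hm.differentiableAt (by norm_num)).hasFDerivAt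
  have D1 : ∀ a, fderiv ℝ m (e, e) (a, 0) = a := fun a => by
    have h := HasFDerivAt.comp (f := fun x => (x, e)) e dm (hasFDerivAt_prodMk_left (𝕜 := ℝ) e e)
    have h' : HasFDerivAt (fun x => m (x, e)) (ContinuousLinearMap.id ℝ E) e :=
      (hasFDerivAt_id e).congr_of_eventuallyEq hm2
    simpa using congrArg (fun L => L a) (h.unique h')
  have D2 : ∀ a, fderiv ℝ m (e, e) (0, a) = a := fun a => by
    have h := HasFDerivAt.comp (f := fun x => (e, x)) e dm (hasFDerivAt_prodMk_right (𝕜 := ℝ) e e)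
    have h' : HasFDerivAt (fun x => m (e, x)) (ContinuousLinearMap.id ℝ E) e :=
      (hasFDerivAt_id e).congr_of_eventuallyEq hm1
    simpa using congrArg (fun L => L a) (h.unique h')
  have hmev : ∀ᶠ p in 𝓝 (e, e), DifferentiableAt ℝ m p :=
    (hm.eventually (by norm_num)).mono fun p hp => hp.differentiableAt (by norm_num)
  have hcev : ∀ᶠ p in 𝓝 (e, e), DifferentiableAt ℝ c p :=
    (hc.eventually (by norm_num)).mono fun p hp => hp.differentiableAt (by norm_num)
  have t1 : Tendsto (fun x : E => (x, e)) (𝓝 e) (𝓝 (e, e)) :=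
    (Continuous.tendsto (by fun_prop) e)
  have t2 : Tendsto (fun x : E => (e, x)) (𝓝 e) (𝓝 (e, e)) :=
    (Continuous.tendsto (by fun_prop) e)
  -- Differentiate `xy = (xyx⁻¹)x` in `y` at `y = e`; differentiating the outcome in `x` at `e` then
  -- gives the claim.
  have key : ∀ᶠ x in 𝓝 e, fderiv ℝ m (x, e) (0, Y) =
      fderiv ℝ m (e, x) (fderiv ℝ c (x, e) (0, Y), 0) := by
    filter_upwards [t1.eventually hmc.eventually_nhds, t1.eventually hmev, t1.eventually hcev,
      t2.eventually hmev, hce] with x h1 h2 h3 h4 h5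
    have hd : HasFDerivAt (fun p : E × E => m (c p, p.1)) _ (x, e) :=
      HasFDerivAt.comp (g := m) (x, e) (by simpa [h5] using h4.hasFDerivAt)
        (h3.hasFDerivAt.prodMk hasFDerivAt_fst)
    have := hd.unique (h2.hasFDerivAt.congr_of_eventuallyEq (EventuallyEq.symm h1))
    simpa using (congrArg (fun L => L (0, Y)) this).symm
  have A0 : fderiv ℝ c (e, e) (0, Y) = Y := by
    have := key.self_of_nhds
    rw [D2, D1] at this
    exact this.symm
  have hL := hasFDerivAt_fderiv_apply_left hm (0, Y)
  have hL' := hasFDerivAt_fderiv_apply_left hm (0, X)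
  have hA := hasFDerivAt_fderiv_apply_left hc (0, Y)
  have hB : HasFDerivAt (fderiv ℝ m) (fderiv ℝ (fderiv ℝ m) (e, e)) (e, e) :=
    ((hm.fderiv_right (m := 1) (by norm_num)).differentiableAt (by norm_num)).hasFDerivAt
  have hR := (HasFDerivAt.comp (f := fun x => (e, x)) e hB
    (hasFDerivAt_prodMk_right (𝕜 := ℝ) e e)).clm_apply
    (hA.prodMk (hasFDerivAt_const (0 : E) e))
  have := hL.unique (hR.congr_of_eventuallyEq key)
  have h3 := congrArg (fun L => L X) this
  -- Symmetry turns the mixed term of `m` into the derivative of the field of `X` in the direction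
  -- `Y`.
  have hsymm : IsSymmSndFDerivAt ℝ m (e, e) := hm.isSymmSndFDerivAt (by simp)
  have h4 := hsymm.eq (0, X) (Y, 0)
  rw [hL.fderiv, hL'.fderiv, hA.fderiv]
  simp [A0, D1, h4] at h3 ⊢
  rw [h3]; abel

end Calculus

/-! ### Integral curves of left-invariant fields and the exponential map -/

section Exponential

open Filter Topology Set

variable {E : Type*} [NormedAddCommGroup E] [NormedSpace ℝ E]
  {N : Type*} [TopologicalSpace N] [ChartedSpace E N] [Group N]

theorem lieGroup_minSmoothness [LieGroup 𝓘(ℝ, E) ∞ N] :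
    LieGroup 𝓘(ℝ, E) (minSmoothness ℝ 3) N :=
  LieGroup.of_le (n := ∞) (by
    rw [minSmoothness_of_isRCLikeNormedField]
    exact WithTop.coe_le_coe.mpr le_top)

attribute [local instance] lieGroup_minSmoothness

variable [LieGroup 𝓘(ℝ, E) ∞ N]

theorem mdifferentiableAt_mul_left (g h : N) :
    MDifferentiableAt 𝓘(ℝ, E) 𝓘(ℝ, E) (fun x : N => g * x) h :=
  (contMDiff_mul_left (I := 𝓘(ℝ, E)) (n := ∞)).contMDiffAt.mdifferentiableAt (by simp)

/-- Left-invariant vector fields are invariant under left translations. -/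
theorem mfderiv_mul_left_mulInvariantVectorField (g h : N) (X : LieAlg E N) :
    mfderiv 𝓘(ℝ, E) 𝓘(ℝ, E) (fun x : N => g * x) h (mulInvariantVectorField X h) =
      mulInvariantVectorField X (g * h) := by
  have h1 : (fun x : N => g * h * x) = (fun x => g * x) ∘ (fun x => h * x) := by
    ext x; simp [mul_assoc]
  have h2 := mfderiv_comp_of_eq (I := 𝓘(ℝ, E)) (I' := 𝓘(ℝ, E)) (I'' := 𝓘(ℝ, E))
    (x := (1 : N)) (y := h) (f := fun x : N => h * x) (g := fun x : N => g * x)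
    (mdifferentiableAt_mul_left g h) (mdifferentiableAt_mul_left h 1) (by simp)
  have h3 : ∀ k, k = h → (mfderiv 𝓘(ℝ, E) 𝓘(ℝ, E) (fun x : N => g * x) h : E →L[ℝ] E) =
      (mfderiv 𝓘(ℝ, E) 𝓘(ℝ, E) (fun x : N => g * x) k : E →L[ℝ] E) := by
    rintro k rfl; rfl
  unfold mulInvariantVectorField
  rw [h1, h2]
  exact congrArg (fun L : E →L[ℝ] E => L (mfderiv 𝓘(ℝ, E) 𝓘(ℝ, E) (fun x : N => h * x) 1 X))
    (h3 (h * 1) (mul_one h))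

theorem isMIntegralCurve_mul_left {X : LieAlg E N} {c : ℝ → N} {s : Set ℝ}
    (hc : IsMIntegralCurveOn (I := 𝓘(ℝ, E)) c (fun g => mulInvariantVectorField X g) s) (g : N) :
    IsMIntegralCurveOn (I := 𝓘(ℝ, E)) (fun t => g * c t)
      (fun g => mulInvariantVectorField X g) s := by
  intro t ht
  have h := (mdifferentiableAt_mul_left (E := E) g (c t)).hasMFDerivAt.comp_hasMFDerivWithinAt t
    (hc t ht)
  refine h.congr_mfderiv ?_
  refine ContinuousLinearMap.ext fun (r : ℝ) => ?_
  exact (ContinuousLinearMap.map_smul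
    (mfderiv 𝓘(ℝ, E) 𝓘(ℝ, E) (fun x : N => g * x) (c t)) r _).trans
    (congrArg (fun w : E => r • w) (mfderiv_mul_left_mulInvariantVectorField g (c t) X))

theorem contMDiff_one_mulInvariantVectorField (X : LieAlg E N) :
    ContMDiff 𝓘(ℝ, E) 𝓘(ℝ, E).tangent 1
      (fun g : N => (⟨g, mulInvariantVectorField X g⟩ : TangentBundle 𝓘(ℝ, E) N)) :=
  (contMDiff_mulInvariantVectorField X).of_le (by
    rw [minSmoothness_of_isRCLikeNormedField]; norm_num)

/-- Left-invariant vector fields are complete. -/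
theorem exists_isMIntegralCurve_mulInvariantVectorField [FiniteDimensional ℝ E] [T2Space N]
    (X : LieAlg E N) :
    ∃ c : ℝ → N, c 0 = 1 ∧
      IsMIntegralCurve (I := 𝓘(ℝ, E)) c (fun g => mulInvariantVectorField X g) := by
  have : CompleteSpace E := FiniteDimensional.complete ℝ E
  have hv := contMDiff_one_mulInvariantVectorField (N := N) X
  obtain ⟨c, hc0, hc⟩ := exists_isMIntegralCurveAt_of_contMDiffAt_boundaryless (t₀ := 0)
    (hv.contMDiffAt (x := (1 : N)))
  obtain ⟨ε, hε, hc⟩ := isMIntegralCurveAt_iff'.mp hc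
  -- Left translates of one local solution give the same existence time `ε` at every point, which
  -- forces completeness.
  refine exists_isMIntegralCurve_of_isMIntegralCurveOn hv hε (fun g => ?_) 1
  refine ⟨fun t => g * c t, by simp [hc0], ?_⟩
  rw [Real.ball_eq_Ioo] at hc
  simpa using isMIntegralCurve_mul_left hc g

variable [FiniteDimensional ℝ E] [T2Space N]

theorem isMIntegralCurve_mulInvariant_unique {X : LieAlg E N} {c d : ℝ → N}
    (hc : IsMIntegralCurve (I := 𝓘(ℝ, E)) c (fun g => mulInvariantVectorField X g))
    (hd : IsMIntegralCurve (I := 𝓘(ℝ, E)) d (fun g => mulInvariantVectorField X g))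
    (h : c 0 = d 0) : c = d :=
  isMIntegralCurve_Ioo_eq_of_contMDiff_boundaryless (contMDiff_one_mulInvariantVectorField X)
    hc hd h

theorem lieExp_eq {X : LieAlg E N} {c : ℝ → N} (hc0 : c 0 = 1)
    (hc : IsMIntegralCurve (I := 𝓘(ℝ, E)) c (fun g => mulInvariantVectorField X g)) :
    lieExp X = c 1 := by
  have h : ∃ c : ℝ → N, c 0 = 1 ∧
      IsMIntegralCurve (I := 𝓘(ℝ, E)) c (fun g => mulInvariantVectorField X g) := ⟨c, hc0, hc⟩
  rw [lieExp, dif_pos h]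
  exact congrFun (isMIntegralCurve_mulInvariant_unique h.choose_spec.2 hc
    (h.choose_spec.1.trans hc0.symm)) 1

theorem lieExp_smul_eq {X : LieAlg E N} {c : ℝ → N} (hc0 : c 0 = 1)
    (hc : IsMIntegralCurve (I := 𝓘(ℝ, E)) c (fun g => mulInvariantVectorField X g)) (t : ℝ) :
    lieExp (t • X) = c t := by
  have h := hc.comp_mul t
  have h2 := lieExp_eq (X := t • X) (c := c ∘ (· * t)) (by simpa using hc0) (by
    rw [show (fun g : N => mulInvariantVectorField (t • X) g) =
      t • (fun g : N => mulInvariantVectorField X g) from mulInvariantVectorField_smul t X]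
    exact h)
  simpa using h2

theorem isMIntegralCurve_lieExp (X : LieAlg E N) :
    IsMIntegralCurve (I := 𝓘(ℝ, E)) (fun t : ℝ => lieExp (t • X))
      (fun g : N => mulInvariantVectorField X g) := by
  obtain ⟨c, hc0, hc⟩ := exists_isMIntegralCurve_mulInvariantVectorField (N := N) X
  have : (fun t : ℝ => lieExp (t • X)) = c := funext fun t => lieExp_smul_eq hc0 hc t
  rwa [this]

theorem lieExp_zero : lieExp (0 : LieAlg E N) = (1 : N) := by
  obtain ⟨c, hc0, hc⟩ := exists_isMIntegralCurve_mulInvariantVectorField (N := N) (0 : LieAlg E N)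
  rw [← zero_smul ℝ (0 : LieAlg E N), lieExp_smul_eq hc0 hc, hc0]

/-- As functions of `t`, the time shift by `s` and the left translate by `exp (s X)` are integral
curves of the same field with the same value at `0`. -/
theorem lieExp_add_smul (X : LieAlg E N) (s t : ℝ) :
    (lieExp ((s + t) • X) : N) = lieExp (s • X) * lieExp (t • X) := by
  have h := isMIntegralCurve_lieExp (N := N) X
  have h1 := (isMIntegralCurve_iff_isMIntegralCurveOn.mpr
    (isMIntegralCurve_mul_left (isMIntegralCurve_iff_isMIntegralCurveOn.mp h) (lieExp (s • X))))
  have h2 := h.comp_add s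
  have h3 := isMIntegralCurve_mulInvariant_unique h2 h1 (by simp [lieExp_zero])
  simpa [add_comm] using congrFun h3 t

end Exponential

/-! ### The group law in the chart around the identity -/

section LocalGroup

open Filter Topology Set

attribute [local instance] lieGroup_minSmoothness

variable {E : Type*} [NormedAddCommGroup E] [NormedSpace ℝ E]
  (N : Type*) [TopologicalSpace N] [ChartedSpace E N] [Group N]

/-- The coordinates of the identity in the preferred chart around it. -/
def oneCoord : E := chartAt E (1 : N) 1

/-- The group law of `N` in the preferred chart around the identity. -/
def locMul (p : E × E) : E :=
  chartAt E (1 : N) ((chartAt E (1 : N)).symm p.1 * (chartAt E (1 : N)).symm p.2)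

/-- Conjugation in `N` in the preferred chart around the identity. -/
def locConj (p : E × E) : E :=
  chartAt E (1 : N) ((chartAt E (1 : N)).symm p.1 * (chartAt E (1 : N)).symm p.2 *
    ((chartAt E (1 : N)).symm p.1)⁻¹)

@[simp] theorem chartAt_one_symm_oneCoord : (chartAt E (1 : N)).symm (oneCoord N) = 1 :=
  (chartAt E (1 : N)).left_inv (mem_chart_source E 1)

variable {N}

theorem contMDiffAt_chartAt_one [IsManifold 𝓘(ℝ, E) ∞ N] :
    ContMDiffAt 𝓘(ℝ, E) 𝓘(ℝ, E) ∞ (chartAt E (1 : N)) 1 :=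
  contMDiffAt_of_mem_maximalAtlas (IsManifold.chart_mem_maximalAtlas 1) (mem_chart_source E 1)

theorem contMDiffAt_chartAt_one_symm [IsManifold 𝓘(ℝ, E) ∞ N] :
    ContMDiffAt 𝓘(ℝ, E) 𝓘(ℝ, E) ∞ (chartAt E (1 : N)).symm (oneCoord N) :=
  contMDiffAt_symm_of_mem_maximalAtlas (IsManifold.chart_mem_maximalAtlas 1)
    (mem_chart_target E 1)

section

variable {F : Type*} [NormedAddCommGroup F] [NormedSpace ℝ F]

theorem ContMDiffAt.contDiffAt_chartAt_one [IsManifold 𝓘(ℝ, E) ∞ N] {f : F → N} {x : F}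
    (hf : ContMDiffAt 𝓘(ℝ, F) 𝓘(ℝ, E) ∞ f x) (hx : f x = 1) :
    ContDiffAt ℝ ∞ (fun y => chartAt E (1 : N) (f y)) x := by
  rw [← contMDiffAt_iff_contDiffAt]
  exact ContMDiffAt.comp_of_eq (g := chartAt E (1 : N)) contMDiffAt_chartAt_one hf hx

theorem chartAt_one_symm_eventuallyEq {f : F → N} {x : F} (hf : ContinuousAt f x) (hx : f x = 1) :
    ∀ᶠ y in 𝓝 x, (chartAt E (1 : N)).symm (chartAt E (1 : N) (f y)) = f y := by
  have : ∀ᶠ y in 𝓝 x, f y ∈ (chartAt E (1 : N)).source :=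
    hf.eventually_mem ((chartAt E (1 : N)).open_source.mem_nhds
      (by rw [hx]; exact mem_chart_source E 1))
  exact this.mono fun y hy => (chartAt E (1 : N)).left_inv hy

theorem contMDiffAt_of_contDiffAt_chartAt_one [IsManifold 𝓘(ℝ, E) ∞ N] {f : F → N} {x : F}
    (hc : ContinuousAt f x) (hf : ContDiffAt ℝ ∞ (fun y => chartAt E (1 : N) (f y)) x)
    (hx : f x = 1) : ContMDiffAt 𝓘(ℝ, F) 𝓘(ℝ, E) ∞ f x := by
  have h := ContMDiffAt.comp_of_eq (g := (chartAt E (1 : N)).symm)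
    (contMDiffAt_chartAt_one_symm (N := N)) hf.contMDiffAt (by rw [hx]; rfl)
  exact h.congr_of_eventuallyEq ((chartAt_one_symm_eventuallyEq hc hx).mono fun y hy => hy.symm)

end

theorem continuousAt_chartAt_one_symm :
    ContinuousAt (chartAt E (1 : N)).symm (oneCoord N) :=
  (chartAt E (1 : N)).continuousAt_symm (mem_chart_target E 1)

variable [LieGroup 𝓘(ℝ, E) ∞ N]

theorem contMDiffAt_symm_fst :
    ContMDiffAt 𝓘(ℝ, E × E) 𝓘(ℝ, E) ∞ (fun p : E × E => (chartAt E (1 : N)).symm p.1)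
      (oneCoord N, oneCoord N) :=
  ContMDiffAt.comp (g := (chartAt E (1 : N)).symm) (f := Prod.fst) (oneCoord N, oneCoord N)
    (contMDiffAt_chartAt_one_symm (N := N)) contDiff_fst.contMDiff.contMDiffAt

theorem contMDiffAt_symm_snd :
    ContMDiffAt 𝓘(ℝ, E × E) 𝓘(ℝ, E) ∞ (fun p : E × E => (chartAt E (1 : N)).symm p.2)
      (oneCoord N, oneCoord N) :=
  ContMDiffAt.comp (g := (chartAt E (1 : N)).symm) (f := Prod.snd) (oneCoord N, oneCoord N)
    (contMDiffAt_chartAt_one_symm (N := N)) contDiff_snd.contMDiff.contMDiffAt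

theorem contDiffAt_locMul : ContDiffAt ℝ ∞ (locMul (E := E) N) (oneCoord N, oneCoord N) :=
  ContMDiffAt.contDiffAt_chartAt_one (contMDiffAt_symm_fst.mul contMDiffAt_symm_snd) (by simp)

theorem contDiffAt_locConj : ContDiffAt ℝ ∞ (locConj (E := E) N) (oneCoord N, oneCoord N) :=
  ContMDiffAt.contDiffAt_chartAt_one
    ((contMDiffAt_symm_fst.mul contMDiffAt_symm_snd).mul contMDiffAt_symm_fst.inv) (by simp)

theorem locMul_oneCoord_left : ∀ᶠ y in 𝓝 (oneCoord (E := E) N), locMul N (oneCoord N, y) = y := by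
  filter_upwards [(chartAt E (1 : N)).open_target.mem_nhds (mem_chart_target E 1)] with y hy
  simp [locMul, (chartAt E (1 : N)).right_inv hy]

theorem locMul_oneCoord_right :
    ∀ᶠ y in 𝓝 (oneCoord (E := E) N), locMul N (y, oneCoord N) = y := by
  filter_upwards [(chartAt E (1 : N)).open_target.mem_nhds (mem_chart_target E 1)] with y hy
  simp [locMul, (chartAt E (1 : N)).right_inv hy]

theorem locConj_oneCoord (x : E) : locConj N (x, oneCoord N) = oneCoord N := by
  simp [locConj, oneCoord]

/-- The identity `xy = (xyx⁻¹)x` in coordinates, in the form needed by `fderiv_conj_eq`. -/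
theorem locMul_eq_locMul_locConj :
    ∀ᶠ p in 𝓝 (oneCoord (E := E) N, oneCoord (E := E) N),
      locMul N p = locMul N (locConj N p, p.1) := by
  have h := chartAt_one_symm_eventuallyEq (E := E) (F := E × E)
    (f := fun p => (chartAt E (1 : N)).symm p.1 * (chartAt E (1 : N)).symm p.2 *
      ((chartAt E (1 : N)).symm p.1)⁻¹) ((contMDiffAt_symm_fst.mul
    contMDiffAt_symm_snd).mul contMDiffAt_symm_fst.inv).continuousAt (by simp)
  filter_upwards [h] with p hp
  simp only [locMul, locConj]
  rw [hp]; simp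

theorem hasFDerivAt_locMul :
    HasFDerivAt (locMul N) (ContinuousLinearMap.fst ℝ E E + ContinuousLinearMap.snd ℝ E E)
      (oneCoord N, oneCoord N) := by
  have dm := (contDiffAt_locMul (E := E) (N := N)).differentiableAt (by simp) |>.hasFDerivAt
  have h1 := HasFDerivAt.comp (f := fun x => (x, oneCoord N)) (oneCoord N) dm
    (hasFDerivAt_prodMk_left (𝕜 := ℝ) _ _)
  have h1' := h1.unique ((hasFDerivAt_id (oneCoord N)).congr_of_eventuallyEq locMul_oneCoord_right)
  have h2 := HasFDerivAt.comp (f := fun x => (oneCoord N, x)) (oneCoord N) dm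
    (hasFDerivAt_prodMk_right (𝕜 := ℝ) _ _)
  have h2' := h2.unique ((hasFDerivAt_id (oneCoord N)).congr_of_eventuallyEq locMul_oneCoord_left)
  refine dm.congr_fderiv ?_
  ext v
  · simpa using congrArg (fun L => L v) h1'
  · simpa using congrArg (fun L => L v) h2'

/-- In the chart around the identity, derivatives of products of maps add up. -/
theorem hasFDerivAt_chartAt_one_mul {F : Type*} [NormedAddCommGroup F] [NormedSpace ℝ F]
    {f g : F → N} {x : F} {A B : F →L[ℝ] E} (hfc : ContinuousAt f x) (hgc : ContinuousAt g x)
    (hfx : f x = 1) (hgx : g x = 1)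
    (hf : HasFDerivAt (fun y => chartAt E (1 : N) (f y)) A x)
    (hg : HasFDerivAt (fun y => chartAt E (1 : N) (g y)) B x) :
    HasFDerivAt (fun y => chartAt E (1 : N) (f y * g y)) (A + B) x := by
  have hm : HasFDerivAt (locMul N)
      (ContinuousLinearMap.fst ℝ E E + ContinuousLinearMap.snd ℝ E E)
      (chartAt E (1 : N) (f x), chartAt E (1 : N) (g x)) := by
    rw [hfx, hgx]; exact hasFDerivAt_locMul
  have h := HasFDerivAt.comp x hm (hf.prodMk hg)
  refine (h.congr_fderiv (by ext; simp)).congr_of_eventuallyEq ?_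
  filter_upwards [chartAt_one_symm_eventuallyEq (E := E) hfc hfx,
    chartAt_one_symm_eventuallyEq (E := E) hgc hgx] with y h1 h2
  simp [locMul, h1, h2]

end LocalGroup

/-! ### One-parameter subgroups and their smoothness -/

section OneParameterSubgroups

open Filter Topology Set

attribute [local instance] lieGroup_minSmoothness

variable {E : Type*} [NormedAddCommGroup E] [NormedSpace ℝ E]
  {N : Type*} [TopologicalSpace N] [ChartedSpace E N] [Group N]

variable (N) in
/-- The exponential map of `N`, as a map defined on the model space. -/
def expMap (x : E) : N := lieExp (show LieAlg E N from x)

/-- `c` is the one-parameter subgroup with initial velocity `X`. -/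
structure IsOneParam (c : ℝ → N) (X : E) : Prop where
  map_add : ∀ s t, c (s + t) = c s * c t
  continuousAt : ContinuousAt c 0
  hasDerivAt : HasDerivAt (fun t => chartAt E (1 : N) (c t)) X 0

/-- Keeping `p` separate from `f x` allows the chart at `1` to be used when `f x = 1` holds only
propositionally. -/
theorem hasMFDerivAt_iff_chartAt {F : Type*} [NormedAddCommGroup F] [NormedSpace ℝ F]
    {f : F → N} {x : F} {A : F →L[ℝ] E} {p : N} (hp : f x = p) :
    HasMFDerivAt 𝓘(ℝ, F) 𝓘(ℝ, E) f x A ↔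
      ContinuousAt f x ∧ HasFDerivAt (fun y => chartAt E p (f y)) A x := by
  subst hp
  simp only [HasMFDerivAt, writtenInExtChartAt, mfld_simps]
  exact and_congr Iff.rfl (hasFDerivWithinAt_univ (𝕜 := ℝ) (E := F) (F := E)
    (f := fun y => chartAt E (f x) (f y)) (f' := A) (x := x))

namespace IsOneParam

variable {c d : ℝ → N} {X Y : E}

theorem map_zero (hc : IsOneParam c X) : c 0 = 1 := by
  have := hc.map_add 0 0
  simpa using this

variable [LieGroup 𝓘(ℝ, E) ∞ N]

/-- Writing `c s = c t * c (s - t)` shows that the velocity at `t` is the left translate of the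
velocity at `0`. A homomorphism differentiable at `0` is thus an integral curve, so it is determined
by `X`. -/
theorem isMIntegralCurve (hc : IsOneParam c X) :
    IsMIntegralCurve (I := 𝓘(ℝ, E)) c
      (fun g => mulInvariantVectorField (show LieAlg E N from X) g) := by
  intro t
  have h0 : HasMFDerivAt 𝓘(ℝ, ℝ) 𝓘(ℝ, E) (fun s => c (s - t)) t
      (ContinuousLinearMap.smulRight (1 : ℝ →L[ℝ] ℝ) X) := by
    refine (hasMFDerivAt_iff_chartAt (F := ℝ) (p := (1 : N)) (by simp [hc.map_zero])).mpr ⟨?_, ?_⟩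
    · exact ContinuousAt.comp (f := fun s => s - t) (g := c) (by simpa using hc.continuousAt)
        (by fun_prop)
    · have h1 : HasDerivAt (fun t => chartAt E (1 : N) (c t)) X (t - t) := by
        simpa using hc.hasDerivAt
      exact (h1.comp_sub_const t t).hasFDerivAt
  have h1 : c = fun s => c t * c (s - t) := by
    ext s; rw [← hc.map_add]; simp
  have h3 : ∀ k : N, k = 1 → HasMFDerivAt 𝓘(ℝ, E) 𝓘(ℝ, E) (fun x : N => c t * x) k
      (mfderiv 𝓘(ℝ, E) 𝓘(ℝ, E) (fun x : N => c t * x) 1 : E →L[ℝ] E) := by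
    rintro k rfl
    exact (mdifferentiableAt_mul_left (E := E) (c t) 1).hasMFDerivAt
  have h2 := HasMFDerivAt.comp t (h3 (c (t - t)) (by simp [hc.map_zero])) h0
  have h4 : HasMFDerivAt 𝓘(ℝ, ℝ) 𝓘(ℝ, E) c t
      ((mfderiv 𝓘(ℝ, E) 𝓘(ℝ, E) (fun x : N => c t * x) 1 : E →L[ℝ] E).comp
        (ContinuousLinearMap.smulRight (1 : ℝ →L[ℝ] ℝ) X)) :=
    HasMFDerivAt.congr_of_eventuallyEq h2 (EventuallyEq.of_eq h1)
  refine h4.congr_mfderiv (ContinuousLinearMap.ext fun (r : ℝ) => ?_)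
  exact ContinuousLinearMap.map_smul
    (mfderiv 𝓘(ℝ, E) 𝓘(ℝ, E) (fun x : N => c t * x) 1) r _

variable [FiniteDimensional ℝ E] [T2Space N]

theorem eq_expMap (hc : IsOneParam c X) (t : ℝ) : c t = expMap N (t • X) :=
  (lieExp_smul_eq hc.map_zero hc.isMIntegralCurve t).symm

theorem expMap_eq (hc : IsOneParam c X) : expMap N X = c 1 := by
  rw [hc.eq_expMap, one_smul]

end IsOneParam

variable [LieGroup 𝓘(ℝ, E) ∞ N] [FiniteDimensional ℝ E] [T2Space N]

theorem isOneParam_expMap (X : E) : IsOneParam (fun t : ℝ => expMap N (t • X)) X where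
  map_add s t := lieExp_add_smul (N := N) (show LieAlg E N from X) s t
  continuousAt := (isMIntegralCurve_lieExp (N := N) (show LieAlg E N from X) 0).continuousAt
  hasDerivAt := by
    have h := isMIntegralCurve_lieExp (N := N) (show LieAlg E N from X) 0
    have h0 : lieExp ((0 : ℝ) • (show LieAlg E N from X)) = (1 : N) := by
      rw [zero_smul, lieExp_zero]
    have h1 := ((hasMFDerivAt_iff_chartAt (F := ℝ) (p := (1 : N)) h0).mp h).2
    have h2 : ∀ k : N, k = 1 → (mulInvariantVectorField (show LieAlg E N from X) k : E) = X := by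
      rintro k rfl
      have : (fun x : N => 1 * x) = id := by ext; simp
      unfold mulInvariantVectorField
      rw [this, mfderiv_id]
      rfl
    have h3 := h1.hasDerivAt
    refine h3.congr_deriv ?_
    refine Eq.trans ?_ (h2 _ h0)
    exact one_smul ℝ (_ : E)

@[simp] theorem expMap_zero : expMap N (0 : E) = 1 := lieExp_zero (N := N)

theorem expMap_add_smul (X : E) (s t : ℝ) :
    expMap N ((s + t) • X) = expMap N (s • X) * expMap N (t • X) :=
  (isOneParam_expMap X).map_add s t

theorem expMap_neg (X : E) : expMap N (-X) = (expMap N X)⁻¹ := by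
  have h := expMap_add_smul (N := N) X 1 (-1)
  simp only [add_neg_cancel, zero_smul, expMap_zero, one_smul, neg_smul] at h
  exact (inv_eq_of_mul_eq_one_right h.symm).symm

/-- One-parameter subgroups are smooth at `0`. -/
theorem IsOneParam.contDiffAt {c : ℝ → N} {X : E} (hc : IsOneParam c X) :
    ContDiffAt ℝ ∞ (fun t => chartAt E (1 : N) (c t)) 0 := by
  set u : ℝ → E := fun t => chartAt E (1 : N) (c t) with hu
  have hu0 : u 0 = oneCoord N := by simp [hu, hc.map_zero, oneCoord]
  have huc : ContinuousAt u 0 := hc.hasDerivAt.continuousAt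
  have hev := chartAt_one_symm_eventuallyEq (E := E) hc.continuousAt hc.map_zero
  -- the differential equation in the chart
  have hmd : ∀ᶠ p in 𝓝 (oneCoord (E := E) N, oneCoord (E := E) N), ContDiffAt ℝ 1 (locMul N) p :=
    ((contDiffAt_locMul (E := E) (N := N)).of_le (m := 1) (by norm_cast)).eventually
      (by norm_num)
  have htend : Tendsto (fun t => (u t, oneCoord (E := E) N)) (𝓝 0)
      (𝓝 (oneCoord (E := E) N, oneCoord (E := E) N)) := by
    have : Tendsto u (𝓝 0) (𝓝 (oneCoord N)) := hu0 ▸ huc.tendsto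
    exact this.prodMk_nhds tendsto_const_nhds
  have hode : ∀ᶠ t in 𝓝 (0 : ℝ), HasDerivAt u (fderiv ℝ (locMul N) (u t, oneCoord N) (0, X)) t := by
    filter_upwards [htend.eventually hmd, hev] with t ht htev
    have h1 : HasFDerivAt (locMul N) (fderiv ℝ (locMul N) (u t, oneCoord N)) (u t, u (t - t)) := by
      rw [sub_self, hu0]
      exact (ht.differentiableAt (by norm_num)).hasFDerivAt
    have h2 : HasDerivAt (fun s => u (s - t)) X t := by
      have h1 : HasDerivAt u X (t - t) := by simpa using hc.hasDerivAt
      exact h1.comp_sub_const t t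
    have h3 := HasFDerivAt.comp_hasDerivAt t h1 ((hasDerivAt_const t (u t)).prodMk h2)
    refine h3.congr_of_eventuallyEq ?_
    have h4 : Tendsto (fun s => s - t) (𝓝 t) (𝓝 0) := by
      have : ContinuousAt (fun s : ℝ => s - t) t := by fun_prop
      simpa [ContinuousAt] using this
    filter_upwards [h4.eventually hev] with s hs
    simp only [Function.comp_apply, locMul, hu, htev, hs, ← hc.map_add]
    simp
  have hVev : ∀ᶠ x in 𝓝 (oneCoord (E := E) N), ContDiffAt ℝ ∞
      (fun x => fderiv ℝ (locMul N) (x, oneCoord N) (0, X)) x := by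
    -- Smoothness of order `∞` at a point need not spread to a neighbourhood, so an open set of
    -- smoothness is exhibited instead of using `contDiffAt_locMul`.
    obtain ⟨U, hU, hUo, hUm⟩ : ∃ U ∈ 𝓝 (oneCoord (E := E) N, oneCoord (E := E) N), IsOpen U ∧
        ContDiffOn ℝ ∞ (locMul (E := E) N) U := by
      have h1 : ContMDiffOn 𝓘(ℝ, E × E) 𝓘(ℝ, E) ∞ (fun p : E × E => (chartAt E (1 : N)).symm p.1)
          ((chartAt E (1 : N)).target ×ˢ (chartAt E (1 : N)).target) :=
        (contMDiffOn_chart_symm (I := 𝓘(ℝ, E)) (n := ∞) (x := (1 : N))).comp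
          (contDiff_fst.contMDiff.contMDiffOn) (fun p hp => hp.1)
      have h2 : ContMDiffOn 𝓘(ℝ, E × E) 𝓘(ℝ, E) ∞ (fun p : E × E => (chartAt E (1 : N)).symm p.2)
          ((chartAt E (1 : N)).target ×ˢ (chartAt E (1 : N)).target) :=
        (contMDiffOn_chart_symm (I := 𝓘(ℝ, E)) (n := ∞) (x := (1 : N))).comp
          (contDiff_snd.contMDiff.contMDiffOn) (fun p hp => hp.2)
      have h12 := h1.mul h2
      have hopen := h12.continuousOn.isOpen_inter_preimage
        ((chartAt E (1 : N)).open_target.prod (chartAt E (1 : N)).open_target)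
        (chartAt E (1 : N)).open_source
      refine ⟨_, hopen.mem_nhds ⟨⟨mem_chart_target E 1, mem_chart_target E 1⟩, ?_⟩, hopen, ?_⟩
      · simp
      · rw [← contMDiffOn_iff_contDiffOn]
        exact (contMDiffOn_chart (I := 𝓘(ℝ, E)) (n := ∞) (x := (1 : N))).comp
          (h12.mono inter_subset_left) (fun p hp => hp.2)
    have hU' : ∀ᶠ x in 𝓝 (oneCoord (E := E) N), (x, oneCoord (E := E) N) ∈ U :=
      (Continuous.tendsto (f := fun x : E => (x, oneCoord (E := E) N)) (by fun_prop) _).eventually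
        (by simpa using hU)
    filter_upwards [hU'] with x hx
    have h1 : ContDiffAt ℝ ∞ (fderiv ℝ (locMul (E := E) N)) (x, oneCoord N) :=
      (hUm.contDiffAt (hUo.mem_nhds hx)).fderiv_right (by simp)
    exact (ContDiffAt.comp (f := fun x : E => (x, oneCoord (E := E) N)) x h1
      (by fun_prop)).clm_apply contDiffAt_const
  obtain ⟨V, hV, hVo, hVe⟩ := mem_nhds_iff.mp hVev
  have hboth := hode.and (huc.eventually_mem (hVo.mem_nhds (hu0 ▸ hVe)))
  obtain ⟨ε, hε, hball⟩ := Metric.eventually_nhds_iff_ball.mp hboth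
  have hIcc : ∀ t ∈ Icc (-(ε / 2)) (ε / 2), t ∈ Metric.ball (0 : ℝ) ε := fun t ht => by
    rw [Real.ball_eq_Ioo]; constructor <;> linarith [ht.1, ht.2]
  -- A solution of a differential equation with smooth right-hand side is smooth.
  have := ODE.contDiffOn_enat_Icc_of_hasDerivWithinAt (n := ⊤) (E := E)
    (f := fun _ x => fderiv ℝ (locMul N) (x, oneCoord N) (0, X)) (u := V) (α := u)
    (tmin := -(ε / 2)) (tmax := ε / 2)
    (by
      rintro ⟨t, x⟩ ⟨_, hx⟩
      exact (ContDiffAt.comp (g := fun x => fderiv ℝ (locMul N) (x, oneCoord N) (0, X))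
        (f := Prod.snd) (t, x) (mem_ofPred.mp (hV hx)) contDiffAt_snd).contDiffWithinAt)
    (fun t ht => (hball t (hIcc t ht)).1.hasDerivWithinAt)
    (fun t ht => (hball t (hIcc t ht)).2)
  exact this.contDiffAt (Icc_mem_nhds (by linarith) (by linarith))

end OneParameterSubgroups

/-! ### The adjoint action and its derivative -/

section Adjoint

open Filter Topology Set VectorField

attribute [local instance] lieGroup_minSmoothness

variable {E : Type*} [NormedAddCommGroup E] [NormedSpace ℝ E]
  {N : Type*} [TopologicalSpace N] [ChartedSpace E N] [Group N]

variable (N) in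
/-- The Lie bracket of `𝔫`, as an operation on the model space. -/
def br (X Y : E) : E := show LieAlg E N from ⁅(show LieAlg E N from X), (show LieAlg E N from Y)⁆

theorem hasMFDerivAt_chartAt_one_symm :
    HasMFDerivAt 𝓘(ℝ, E) 𝓘(ℝ, E) (chartAt E (1 : N)).symm (oneCoord N)
      (ContinuousLinearMap.id ℝ E) := by
  refine (hasMFDerivAt_iff_chartAt (F := E) (chartAt_one_symm_oneCoord N)).mpr
    ⟨continuousAt_chartAt_one_symm, ?_⟩
  refine (hasFDerivAt_id (oneCoord N)).congr_of_eventuallyEq ?_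
  filter_upwards [(chartAt E (1 : N)).open_target.mem_nhds (mem_chart_target E 1)] with y hy
  exact (chartAt E (1 : N)).right_inv hy

variable [LieGroup 𝓘(ℝ, E) ∞ N]

/-- Left-invariant fields in the preferred chart around the identity. -/
theorem mpullbackWithin_mulInvariantVectorField (X : E) {x : E}
    (hx : x ∈ (chartAt E (1 : N)).target)
    (hd : DifferentiableAt ℝ (locMul N) (x, oneCoord (E := E) N)) :
    (mpullbackWithin 𝓘(ℝ, E) 𝓘(ℝ, E) (extChartAt 𝓘(ℝ, E) (1 : N)).symm
      (mulInvariantVectorField (show LieAlg E N from X)) (range 𝓘(ℝ, E)) x : E) =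
      fderiv ℝ (locMul N) (x, oneCoord N) (0, X) := by
  have hx' : x ∈ (extChartAt 𝓘(ℝ, E) (1 : N)).target := by simpa using hx
  set g : N := (extChartAt 𝓘(ℝ, E) (1 : N)).symm x with hg
  have hgs : g ∈ (extChartAt 𝓘(ℝ, E) (1 : N)).source :=
    (extChartAt 𝓘(ℝ, E) (1 : N)).map_target hx'
  have hinv : (mfderivWithin 𝓘(ℝ, E) 𝓘(ℝ, E) (extChartAt 𝓘(ℝ, E) (1 : N)).symm
      (range 𝓘(ℝ, E)) x).inverse = mfderiv 𝓘(ℝ, E) 𝓘(ℝ, E) (extChartAt 𝓘(ℝ, E) (1 : N)) g :=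
    ContinuousLinearMap.inverse_eq (mfderivWithin_extChartAt_symm_comp_mfderiv_extChartAt hx')
      (mfderiv_extChartAt_comp_mfderivWithin_extChartAt_symm hx')
  have hD : ∀ k : N, k = g → HasMFDerivAt 𝓘(ℝ, E) 𝓘(ℝ, E) (extChartAt 𝓘(ℝ, E) (1 : N)) k
      (mfderiv 𝓘(ℝ, E) 𝓘(ℝ, E) (extChartAt 𝓘(ℝ, E) (1 : N)) g : E →L[ℝ] E) := by
    rintro k rfl
    exact (mdifferentiableAt_extChartAt (by simpa using hgs)).hasMFDerivAt
  have hM : ∀ k : N, k = 1 → HasMFDerivAt 𝓘(ℝ, E) 𝓘(ℝ, E) (fun n : N => g * n) k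
      (mfderiv 𝓘(ℝ, E) 𝓘(ℝ, E) (fun n : N => g * n) 1 : E →L[ℝ] E) := by
    rintro k rfl
    exact (mdifferentiableAt_mul_left (E := E) g 1).hasMFDerivAt
  have h1 := HasMFDerivAt.comp (oneCoord (E := E) N) (hM _ (chartAt_one_symm_oneCoord N))
    hasMFDerivAt_chartAt_one_symm
  have h2 := HasMFDerivAt.comp (oneCoord (E := E) N) (hD _ (by simp)) h1
  have h3 : HasFDerivAt (fun y : E => locMul N (x, y))
      ((mfderiv 𝓘(ℝ, E) 𝓘(ℝ, E) (extChartAt 𝓘(ℝ, E) (1 : N)) g : E →L[ℝ] E).comp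
        ((mfderiv 𝓘(ℝ, E) 𝓘(ℝ, E) (fun n : N => g * n) 1 : E →L[ℝ] E).comp
          (ContinuousLinearMap.id ℝ E))) (oneCoord N) :=
    hasMFDerivAt_iff_hasFDerivAt.mp h2
  have h4 := HasFDerivAt.comp (f := fun y => (x, y)) (oneCoord (E := E) N) hd.hasFDerivAt
    (hasFDerivAt_prodMk_right (𝕜 := ℝ) _ _)
  have h5 := congrArg (fun L : E →L[ℝ] E => L X) (HasFDerivAt.unique (𝕜 := ℝ) (E := E) (F := E) h3 h4)
  refine Eq.trans ?_ (h5.trans ?_)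
  · exact congrArg (fun L : E →L[ℝ] E => L _) hinv
  · simp

/-- The preferred chart has identity derivative at its base point, so pulling the bracket back to
the manifold changes nothing. -/
theorem lie_eq_lieBracket_chart (X Y : LieAlg E N) : ⁅X, Y⁆ =
    lieBracket ℝ (mpullbackWithin 𝓘(ℝ, E) 𝓘(ℝ, E) (extChartAt 𝓘(ℝ, E) (1 : N)).symm
        (mulInvariantVectorField X) (range 𝓘(ℝ, E)))
      (mpullbackWithin 𝓘(ℝ, E) 𝓘(ℝ, E) (extChartAt 𝓘(ℝ, E) (1 : N)).symm
        (mulInvariantVectorField Y) (range 𝓘(ℝ, E))) (extChartAt 𝓘(ℝ, E) (1 : N) 1) := by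
  rw [GroupLieAlgebra.bracket_def, ← mlieBracketWithin_univ, mlieBracketWithin_apply]
  have hD : (mfderiv 𝓘(ℝ, E) 𝓘(ℝ, E) (extChartAt 𝓘(ℝ, E) (1 : N)) 1 : E →L[ℝ] E) =
    ContinuousLinearMap.id ℝ E := mfderiv_extChartAt_self
  have hi : ∀ L : E →L[ℝ] E, L = ContinuousLinearMap.id ℝ E → ∀ v, L.inverse v = v := by
    rintro _ rfl v; simp
  have hs : ∀ (V W : E → E) (s : Set E) (x : E), s = univ →
      lieBracketWithin ℝ V W s x = lieBracket ℝ V W x := by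
    rintro V W _ x rfl; rw [lieBracketWithin_univ]
  exact (hi _ hD _).trans (hs _ _ _ _ (by simp))

/-- The Lie bracket through the second derivative of the group law in the preferred chart. -/
theorem br_eq (X Y : E) : br N X Y =
    fderiv ℝ (fun x => fderiv ℝ (locMul N) (x, oneCoord N) (0, Y)) (oneCoord N) X -
      fderiv ℝ (fun x => fderiv ℝ (locMul N) (x, oneCoord N) (0, X)) (oneCoord N) Y := by
  have hmd : ∀ᶠ p in 𝓝 (oneCoord (E := E) N, oneCoord (E := E) N),
      DifferentiableAt ℝ (locMul N) p :=
    (((contDiffAt_locMul (E := E) (N := N)).of_le (m := 1) (by norm_cast)).eventually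
      (by norm_num)).mono fun p hp => hp.differentiableAt (by norm_num)
  have hmd' : ∀ᶠ x in 𝓝 (oneCoord (E := E) N), DifferentiableAt ℝ (locMul N) (x, oneCoord N) :=
    (Continuous.tendsto (f := fun x : E => (x, oneCoord (E := E) N)) (by fun_prop) _).eventually hmd
  have hev : ∀ Z : E, (mpullbackWithin 𝓘(ℝ, E) 𝓘(ℝ, E) (extChartAt 𝓘(ℝ, E) (1 : N)).symm
      (mulInvariantVectorField (show LieAlg E N from Z)) (range 𝓘(ℝ, E)) : E → E)
      =ᶠ[𝓝 (oneCoord N)] fun x => fderiv ℝ (locMul N) (x, oneCoord N) (0, Z) := fun Z => by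
    filter_upwards [hmd', (chartAt E (1 : N)).open_target.mem_nhds (mem_chart_target E 1)]
      with x h1 h2 using mpullbackWithin_mulInvariantVectorField Z h2 h1
  have h0 : ∀ Z : E, fderiv ℝ (locMul N) (oneCoord N, oneCoord N) (0, Z) = Z := fun Z => by
    rw [(hasFDerivAt_locMul (E := E) (N := N)).fderiv]; simp
  have hL := (hev X).lieBracket_vectorField_eq (𝕜 := ℝ) (hev Y)
  rw [lieBracket, h0, h0] at hL
  exact (lie_eq_lieBracket_chart (N := N) _ _).trans hL

variable (N) in
/-- The adjoint action: the derivative at the identity of conjugation by `g`. -/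
def Ad (g : N) : E →L[ℝ] E :=
  fderiv ℝ (fun y : E => chartAt E (1 : N) (g * (chartAt E (1 : N)).symm y * g⁻¹)) (oneCoord N)

theorem contMDiffAt_conj (g : N) :
    ContMDiffAt 𝓘(ℝ, E) 𝓘(ℝ, E) ∞ (fun y : E => g * (chartAt E (1 : N)).symm y * g⁻¹)
      (oneCoord N) :=
  (contMDiffAt_const.mul contMDiffAt_chartAt_one_symm).mul contMDiffAt_const

theorem hasFDerivAt_conj (g : N) :
    HasFDerivAt (fun y : E => chartAt E (1 : N) (g * (chartAt E (1 : N)).symm y * g⁻¹)) (Ad N g)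
      (oneCoord N) :=
  ((ContMDiffAt.contDiffAt_chartAt_one (contMDiffAt_conj g) (by simp)).differentiableAt
    (by simp)).hasFDerivAt

theorem IsOneParam.conj {c : ℝ → N} {X : E} (hc : IsOneParam c X) (g : N) :
    IsOneParam (fun t => g * c t * g⁻¹) (Ad N g X) where
  map_add s t := by rw [hc.map_add]; group
  continuousAt := by
    have : IsTopologicalGroup N := topologicalGroup_of_lieGroup 𝓘(ℝ, E) ∞
    exact (continuousAt_const.mul hc.continuousAt).mul continuousAt_const
  hasDerivAt := by
    have h1 : HasFDerivAt (fun y : E => chartAt E (1 : N) (g * (chartAt E (1 : N)).symm y * g⁻¹))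
        (Ad N g) (chartAt E (1 : N) (c 0)) := by
      rw [hc.map_zero]; exact hasFDerivAt_conj g
    refine (h1.comp_hasDerivAt 0 hc.hasDerivAt).congr_of_eventuallyEq ?_
    filter_upwards [chartAt_one_symm_eventuallyEq (E := E) hc.continuousAt hc.map_zero] with t ht
    simp [ht]

variable [FiniteDimensional ℝ E] [T2Space N]

theorem expMap_Ad (g : N) (X : E) : expMap N (Ad N g X) = g * expMap N X * g⁻¹ := by
  simpa using ((isOneParam_expMap X).conj g).expMap_eq

/-- Both sides are the velocity at `0` of the same curve, the conjugate of `exp (t X)` by `g h`. -/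
theorem Ad_mul_apply (g h : N) (X : E) : Ad N (g * h) X = Ad N g (Ad N h X) := by
  have h1 := ((isOneParam_expMap (N := N) X).conj (g * h)).hasDerivAt
  have h2 := (((isOneParam_expMap (N := N) X).conj h).conj g).hasDerivAt
  refine h1.unique (h2.congr_of_eventuallyEq (Eventually.of_forall fun t => ?_))
  simp [mul_assoc]

theorem Ad_one_apply (X : E) : Ad N 1 X = X := by
  have h1 := ((isOneParam_expMap (N := N) X).conj 1).hasDerivAt
  refine h1.unique ((isOneParam_expMap (N := N) X).hasDerivAt.congr_of_eventuallyEq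
    (Eventually.of_forall fun t => ?_))
  simp

/-- The derivative of the adjoint action along a one-parameter subgroup, at time `0`. -/
theorem hasDerivAt_Ad_expMap_zero (X Y : E) :
    HasDerivAt (fun t : ℝ => Ad N (expMap N (t • X)) Y) (br N X Y) 0 := by
  have hm := (contDiffAt_locMul (E := E) (N := N)).of_le (m := 2) (by norm_cast)
  have hc := (contDiffAt_locConj (E := E) (N := N)).of_le (m := 2) (by norm_cast)
  have hA := hasFDerivAt_fderiv_apply_left hc (0, Y)
  -- The derivative of the adjoint action and the bracket have the same expression in second
  -- derivatives of the group law.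
  have hval := fderiv_conj_eq hm hc locMul_eq_locMul_locConj
    (Eventually.of_forall locConj_oneCoord) locMul_oneCoord_left locMul_oneCoord_right X Y
  rw [← br_eq, hA.fderiv] at hval
  have h1 := isOneParam_expMap (N := N) X
  have hA' := hA
  rw [show oneCoord N = chartAt E (1 : N) (expMap N ((0 : ℝ) • X)) by simp [oneCoord]] at hA'
  have h2 := HasFDerivAt.comp_hasDerivAt (0 : ℝ)
    (l := fun x => fderiv ℝ (locConj N) (x, oneCoord N) (0, Y)) (l' := _)
    (f := fun t : ℝ => chartAt E (1 : N) (expMap N (t • X))) (by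
      rw [show chartAt E (1 : N) (expMap N ((0 : ℝ) • X)) = oneCoord N by simp [oneCoord]]
      exact hA) h1.hasDerivAt
  rw [hval] at h2
  refine h2.congr_of_eventuallyEq ?_
  have hcd : ∀ᶠ p in 𝓝 (oneCoord (E := E) N, oneCoord (E := E) N),
      DifferentiableAt ℝ (locConj N) p :=
    (hc.eventually (by norm_num)).mono fun p hp => hp.differentiableAt (by norm_num)
  have ht : Tendsto (fun t : ℝ => (chartAt E (1 : N) (expMap N (t • X)), oneCoord (E := E) N))
      (𝓝 0) (𝓝 (oneCoord (E := E) N, oneCoord (E := E) N)) := by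
    have h := h1.hasDerivAt.continuousAt.tendsto
    simp only [zero_smul, expMap_zero] at h
    exact h.prodMk_nhds tendsto_const_nhds
  filter_upwards [ht.eventually hcd, chartAt_one_symm_eventuallyEq (E := E) h1.continuousAt
    h1.map_zero] with t h3 h4
  have h5 := HasFDerivAt.comp (f := fun y => (chartAt E (1 : N) (expMap N (t • X)), y))
    (oneCoord (E := E) N) h3.hasFDerivAt (hasFDerivAt_prodMk_right (𝕜 := ℝ) _ _)
  have h6 := hasFDerivAt_conj (E := E) (expMap N (t • X))
  have h7 := h6.unique (h5.congr_of_eventuallyEq (Eventually.of_forall fun y => by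
    simp [locConj, h4]))
  simpa using congrArg (fun L => L Y) h7

/-- Multiplicativity of `Ad` and `exp (s X) = exp (t X) exp ((s - t) X)` reduce this to time `0`. -/
theorem hasDerivAt_Ad_expMap (X Y : E) (t : ℝ) :
    HasDerivAt (fun t : ℝ => Ad N (expMap N (t • X)) Y) (Ad N (expMap N (t • X)) (br N X Y)) t := by
  have h : (fun s : ℝ => Ad N (expMap N (s • X)) Y) =
      fun s => Ad N (expMap N (t • X)) (Ad N (expMap N ((s - t) • X)) Y) := by
    ext s
    rw [← Ad_mul_apply, ← expMap_add_smul]; simp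
  rw [h]
  have h1 : HasDerivAt (fun t : ℝ => Ad N (expMap N (t • X)) Y) (br N X Y) (t - t) := by
    simpa using hasDerivAt_Ad_expMap_zero X Y
  exact (Ad N (expMap N (t • X))).hasFDerivAt.comp_hasDerivAt t (h1.comp_sub_const t t)

end Adjoint

/-! ### The exponential map of a 2-step nilpotent group -/

section TwoStep

open Filter Topology Set

attribute [local instance] lieGroup_minSmoothness

variable {E : Type*} [NormedAddCommGroup E] [NormedSpace ℝ E]
  {N : Type*} [TopologicalSpace N] [ChartedSpace E N] [Group N]
  [LieGroup 𝓘(ℝ, E) ∞ N] [FiniteDimensional ℝ E]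

variable (E N) in
/-- The Lie bracket of `𝔫` as a bilinear map on the model space. -/
def brL : E →ₗ[ℝ] E →ₗ[ℝ] E :=
  haveI : CompleteSpace E := FiniteDimensional.complete ℝ E
  LinearMap.mk₂ ℝ (br N)
    (fun x y z => add_lie (show LieAlg E N from x) (show LieAlg E N from y) (show LieAlg E N from z))
    (fun c x y => smul_lie c (show LieAlg E N from x) (show LieAlg E N from y))
    (fun x y z => lie_add (show LieAlg E N from x) (show LieAlg E N from y) (show LieAlg E N from z))
    (fun c x y => lie_smul c (show LieAlg E N from x) (show LieAlg E N from y))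

theorem br_eq_brL (x y : E) : br N x y = brL E N x y := rfl

theorem brL_self (x : E) : brL E N x x = 0 :=
  haveI : CompleteSpace E := FiniteDimensional.complete ℝ E
  lie_self (show LieAlg E N from x)

theorem brL_swap (x y : E) : brL E N y x = -brL E N x y := by
  have h := brL_self (N := N) (x + y)
  simp only [map_add, LinearMap.add_apply, brL_self, zero_add, add_zero] at h
  exact eq_neg_of_add_eq_zero_right (by rw [add_comm]; exact h)

theorem IsTwoStep.brL_brL (hN : IsTwoStep E N) (x y w : E) : brL E N (brL E N x y) w = 0 :=
  hN x y w

theorem mem_lieCenter_iff {x : E} : x ∈ lieCenter E N ↔ ∀ y, brL E N x y = 0 := by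
  have : CompleteSpace E := FiniteDimensional.complete ℝ E
  have h : x ∈ lieCenter E N ↔ ∀ y, brL E N y x = 0 := Iff.rfl
  rw [h]
  refine forall_congr' fun y => ?_
  rw [brL_swap x y, neg_eq_zero]

variable [T2Space N]

/-- The derivative in `t` is `Ad (exp (t x)) [x, y] = 0`, so the curve stays at its initial value.
-/
theorem Ad_expMap_of_brL_eq_zero {x y : E} (h : brL E N x y = 0) (t : ℝ) :
    Ad N (expMap N (t • x)) y = y := by
  have hd : ∀ s : ℝ, HasDerivAt (fun t : ℝ => Ad N (expMap N (t • x)) y) 0 s := fun s => by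
    have := hasDerivAt_Ad_expMap (N := N) x y s
    rwa [br_eq_brL, h, map_zero] at this
  have := is_const_of_deriv_eq_zero (fun s => (hd s).differentiableAt) (fun s => (hd s).deriv) t 0
  simpa [Ad_one_apply] using this

theorem commute_expMap {x y : E} (h : brL E N x y = 0) : Commute (expMap N x) (expMap N y) := by
  have h1 := Ad_expMap_of_brL_eq_zero h 1
  have h2 := expMap_Ad (expMap N x) y
  rw [one_smul] at h1
  rw [h1] at h2
  exact eq_mul_inv_iff_mul_eq.mp h2 |>.symm

/-- The exponential series of `ad x` stops after the linear term: `Ad (exp (t x))` fixes `[x, y]`,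
so `Ad (exp (t x)) y` has constant derivative `[x, y]`. -/
theorem Ad_expMap (hN : IsTwoStep E N) (x y : E) : Ad N (expMap N x) y = y + brL E N x y := by
  have hd : ∀ s : ℝ, HasDerivAt
      (fun t : ℝ => Ad N (expMap N (t • x)) y - t • brL E N x y) 0 s := fun s => by
    have h1 := hasDerivAt_Ad_expMap (N := N) x y s
    rw [br_eq_brL, Ad_expMap_of_brL_eq_zero (by rw [brL_swap, hN.brL_brL, neg_zero])] at h1
    exact (h1.sub ((hasDerivAt_id s).smul_const (brL E N x y))).congr_deriv (by simp)
  have := is_const_of_deriv_eq_zero (fun s => (hd s).differentiableAt) (fun s => (hd s).deriv) 1 0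
  simp only [one_smul, zero_smul, expMap_zero, Ad_one_apply, sub_zero] at this
  exact sub_eq_iff_eq_add.mp this

theorem IsOneParam.mul_of_commute {c d : ℝ → N} {x y : E} (hc : IsOneParam c x)
    (hd : IsOneParam d y) (h : ∀ s t, Commute (c s) (d t)) :
    IsOneParam (fun t => c t * d t) (x + y) where
  map_add s t := by
    rw [hc.map_add, hd.map_add]
    have := (h t s).eq
    calc c s * c t * (d s * d t) = c s * (c t * d s) * d t := by group
      _ = c s * d s * (c t * d t) := by rw [this]; group
  continuousAt := by
    have : IsTopologicalGroup N := topologicalGroup_of_lieGroup 𝓘(ℝ, E) ∞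
    exact hc.continuousAt.mul hd.continuousAt
  hasDerivAt := by
    have := hasFDerivAt_chartAt_one_mul hc.continuousAt hd.continuousAt hc.map_zero hd.map_zero
      hc.hasDerivAt.hasFDerivAt hd.hasDerivAt.hasFDerivAt
    simpa using this.hasDerivAt

theorem expMap_add_of_brL_eq_zero {x y : E} (h : brL E N x y = 0) :
    expMap N (x + y) = expMap N x * expMap N y := by
  have := ((isOneParam_expMap (N := N) x).mul_of_commute (isOneParam_expMap y) (fun s t =>
    commute_expMap (by simp [h]))).expMap_eq
  simpa using this

/-- Exponentiate `Ad (exp y) x = x - [x, y]`; the bracket splits off because it is central. -/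
theorem expMap_mul_expMap_swap (hN : IsTwoStep E N) (x y : E) :
    expMap N y * expMap N x = expMap N x * expMap N y * expMap N (-brL E N x y) := by
  have h1 := expMap_Ad (expMap N y) x
  rw [Ad_expMap hN, expMap_add_of_brL_eq_zero (by rw [brL_swap, hN.brL_brL, neg_zero]),
    eq_mul_inv_iff_mul_eq] at h1
  rw [← h1, brL_swap, mul_assoc, mul_assoc,
    (commute_expMap (N := N) (x := -brL E N x y) (y := y) (by simp [hN.brL_brL])).eq]

/-- The Baker-Campbell-Hausdorff formula in a 2-step nilpotent group. -/
theorem expMap_mul (hN : IsTwoStep E N) (x y : E) :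
    expMap N x * expMap N y = expMap N (x + y + (1 / 2 : ℝ) • brL E N x y) := by
  have : IsTopologicalGroup N := topologicalGroup_of_lieGroup 𝓘(ℝ, E) ∞
  set b := brL E N x y with hb
  have hbc : ∀ (r : ℝ) (w : E), Commute (expMap N (r • b)) (expMap N w) := fun r w =>
    commute_expMap (by simp [hb, hN.brL_brL])
  have hx := isOneParam_expMap (N := N) x
  have hy := isOneParam_expMap (N := N) y
  -- The correction is quadratic in `t`, so it does not change the velocity `x + y`.
  have hq : HasDerivAt (fun t : ℝ => chartAt E (1 : N) (expMap N ((-(t ^ 2 / 2)) • b))) 0 0 := by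
    have h1 : HasDerivAt (fun t : ℝ => -(t ^ 2 / 2)) 0 0 := by
      exact ((hasDerivAt_pow 2 (0 : ℝ)).div_const 2).neg.congr_deriv (by simp)
    have h2 : HasDerivAt (fun t : ℝ => chartAt E (1 : N) (expMap N (t • b))) b
        (-((0 : ℝ) ^ 2 / 2)) := by simpa using (isOneParam_expMap (N := N) b).hasDerivAt
    have h3 := h2.scomp (0 : ℝ) h1
    rw [zero_smul] at h3
    exact h3
  have hqc : ContinuousAt (fun t : ℝ => expMap N ((-(t ^ 2 / 2)) • b)) 0 := by
    have h2 : ContinuousAt (fun t : ℝ => expMap N (t • b)) (-((0 : ℝ) ^ 2 / 2)) := by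
      simpa using (isOneParam_expMap (N := N) b).continuousAt
    exact ContinuousAt.comp (f := fun t : ℝ => -(t ^ 2 / 2)) h2 (by fun_prop)
  -- Moving `exp (s y)` past `exp (t x)` costs `exp (-(s t) b)`, exactly the cross term of `-(s +
  -- t)² / 2`. The formula is the value at `t = 1` with the central factor moved across.
  have hc : IsOneParam (fun t : ℝ => expMap N (t • x) * expMap N (t • y) *
      expMap N ((-(t ^ 2 / 2)) • b)) (x + y) :=
    { map_add := fun s t => by
        have h1 := expMap_mul_expMap_swap hN (t • x) (s • y)
        have h2 : -brL E N (t • x) (s • y) = (-(s * t)) • b := by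
          simp [hb, smul_smul]
        rw [h2] at h1
        have h3 : expMap N ((-((s + t) ^ 2 / 2)) • b) = expMap N ((-(s * t)) • b) *
            expMap N ((-(s ^ 2 / 2)) • b) * expMap N ((-(t ^ 2 / 2)) • b) := by
          rw [← expMap_add_smul, ← expMap_add_smul]; congr 2; ring
        rw [h3, hx.map_add, hy.map_add]
        have c1 := (hbc (-(s * t)) (t • y)).eq
        have c2 := (hbc (-(s ^ 2 / 2)) (t • x)).eq
        have c3 := (hbc (-(s ^ 2 / 2)) (t • y)).eq
        have c4 := (hbc (-(s * t)) ((-(s ^ 2 / 2)) • b)).eq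
        generalize expMap N (s • x) = a at *
        generalize expMap N (t • x) = a' at *
        generalize expMap N (s • y) = d at *
        generalize expMap N (t • y) = d' at *
        generalize expMap N ((-(s * t)) • b) = u at *
        generalize expMap N ((-(s ^ 2 / 2)) • b) = v at *
        generalize expMap N ((-(t ^ 2 / 2)) • b) = w at *
        calc a * a' * (d * d') * (u * v * w) = a * a' * d * (d' * u) * v * w := by group
          _ = a * a' * d * u * (d' * v) * w := by rw [← c1]; group
          _ = a * (a' * d * u) * v * d' * w := by rw [← c3]; group
          _ = a * d * (a' * v) * d' * w := by rw [← h1]; group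
          _ = a * d * v * (a' * d' * w) := by rw [← c2]; group
      continuousAt := (hx.continuousAt.mul hy.continuousAt).mul hqc
      hasDerivAt := by
        have h1 := hasFDerivAt_chartAt_one_mul hx.continuousAt hy.continuousAt hx.map_zero
          hy.map_zero hx.hasDerivAt.hasFDerivAt hy.hasDerivAt.hasFDerivAt
        have h2 := hasFDerivAt_chartAt_one_mul (hx.continuousAt.mul hy.continuousAt) hqc
          (by simp) (by simp) h1 hq.hasFDerivAt
        simpa using h2.hasDerivAt }
  have h := hc.expMap_eq
  rw [expMap_add_of_brL_eq_zero (by rw [brL_swap]; simp [hb, hN.brL_brL]), h]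
  simp only [one_smul, one_pow]
  rw [mul_assoc, ← expMap_add_smul]
  norm_num

/-! ### Coordinates of the second kind -/

/-- A product of one-parameter subgroups, as a function of the times. -/
def expProd {ι : Type*} (X : ι → E) (l : List ι) (t : ι → ℝ) : N :=
  (l.map fun i => expMap N (t i • X i)).prod

section ExpProd

variable {ι : Type*} [Fintype ι] (X : ι → E)

theorem contMDiffAt_expMap_smul (x : E) :
    ContMDiffAt 𝓘(ℝ, ℝ) 𝓘(ℝ, E) ∞ (fun t : ℝ => expMap N (t • x)) 0 :=
  contMDiffAt_of_contDiffAt_chartAt_one (isOneParam_expMap x).continuousAt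
    (isOneParam_expMap x).contDiffAt (by simp)

theorem expProd_zero (l : List ι) : (expProd X l 0 : N) = 1 := by
  simp [expProd]

theorem contMDiffAt_expProd (l : List ι) :
    ContMDiffAt 𝓘(ℝ, ι → ℝ) 𝓘(ℝ, E) ∞ (expProd (N := N) X l) 0 := by
  induction l with
  | nil => exact contMDiffAt_const
  | cons i l ih =>
    have h1 : ContMDiffAt 𝓘(ℝ, ι → ℝ) 𝓘(ℝ, E) ∞ (fun t : ι → ℝ => expMap N (t i • X i)) 0 :=
      ContMDiffAt.comp (f := fun t : ι → ℝ => t i) (g := fun t : ℝ => expMap N (t • X i)) 0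
        (contMDiffAt_expMap_smul (X i)) (contDiff_apply ℝ ℝ i).contMDiff.contMDiffAt
    exact h1.mul ih

theorem hasFDerivAt_expProd (l : List ι) :
    HasFDerivAt (fun t => chartAt E (1 : N) (expProd X l t))
      (l.map fun i => (ContinuousLinearMap.proj i : (ι → ℝ) →L[ℝ] ℝ).smulRight (X i)).sum 0 := by
  induction l with
  | nil => simpa [expProd] using hasFDerivAt_const (chartAt E (1 : N) 1) (0 : ι → ℝ)
  | cons i l ih =>
    have h0 : HasDerivAt (fun t : ℝ => chartAt E (1 : N) (expMap N (t • X i))) (X i)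
      ((ContinuousLinearMap.proj i : (ι → ℝ) →L[ℝ] ℝ) 0) := (isOneParam_expMap (X i)).hasDerivAt
    have h1 := h0.hasFDerivAt.comp (0 : ι → ℝ)
      (ContinuousLinearMap.proj i : (ι → ℝ) →L[ℝ] ℝ).hasFDerivAt
    have h2 := hasFDerivAt_chartAt_one_mul
      (f := fun t : ι → ℝ => expMap N (t i • X i)) (g := expProd X l)
      (ContinuousAt.comp (f := fun t : ι → ℝ => t i) (g := fun t : ℝ => expMap N (t • X i))
        (isOneParam_expMap (X i)).continuousAt (continuous_apply i).continuousAt)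
      (contMDiffAt_expProd X l).continuousAt (by simp) (expProd_zero X l) h1 ih
    refine h2.congr_fderiv ?_
    ext; simp

theorem hasFDerivAt_expProd_univ :
    HasFDerivAt (fun t => chartAt E (1 : N) (expProd X Finset.univ.toList t))
      (∑ i, (ContinuousLinearMap.proj i : (ι → ℝ) →L[ℝ] ℝ).smulRight (X i)) 0 := by
  have := hasFDerivAt_expProd (N := N) X Finset.univ.toList
  rwa [Finset.sum_map_toList] at this

/-- The derivative at `0` sends `t` to `∑ i, t i • b i`, which is onto, so the inverse function
theorem applies. It replaces a local inverse of `exp` in proving that the image of `exp` is open and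
that characters are continuous. -/
theorem map_expProd_nhds (b : Module.Basis ι ℝ E) :
    map (expProd (N := N) b Finset.univ.toList) (𝓝 0) = 𝓝 1 := by
  have : CompleteSpace E := FiniteDimensional.complete ℝ E
  set P : (ι → ℝ) → N := expProd b Finset.univ.toList with hP
  have hP0 : P 0 = 1 := expProd_zero b _
  have hPs : ContDiffAt ℝ ∞ (fun t => chartAt E (1 : N) (P t)) 0 :=
    ContMDiffAt.contDiffAt_chartAt_one (contMDiffAt_expProd b _) hP0
  have hd := (hPs.hasStrictFDerivAt (by simp))
  rw [(hasFDerivAt_expProd_univ (N := N) b).fderiv] at hd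
  have hsurj := hd.map_nhds_eq_of_surj (by
    rw [LinearMap.range_eq_top]
    intro v
    exact ⟨b.equivFun v, by simp⟩)
  rw [hP0] at hsurj
  have h1 : map P (𝓝 0) = map (chartAt E (1 : N)).symm (map (fun t => chartAt E (1 : N) (P t))
      (𝓝 0)) := by
    rw [map_map]
    exact map_congr ((chartAt_one_symm_eventuallyEq (E := E)
      (contMDiffAt_expProd b _).continuousAt hP0).mono fun t ht => ht.symm)
  rw [h1, hsurj, (chartAt E (1 : N)).symm.map_nhds_eq (mem_chart_target E 1)]
  exact congrArg 𝓝 (chartAt_one_symm_oneCoord N)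

end ExpProd

/-! ### Surjectivity of the exponential map, the center, and continuity of characters -/

variable (N) in
/-- In a connected 2-step nilpotent group, the exponential map is onto. -/
theorem surjective_expMap [ConnectedSpace N] (hN : IsTwoStep E N) :
    Function.Surjective (expMap (E := E) N) := by
  have : IsTopologicalGroup N := topologicalGroup_of_lieGroup 𝓘(ℝ, E) ∞
  -- The product formula makes the image a subgroup; it contains a neighbourhood of `1`, so it is
  -- open and closed in a connected group.
  let H : Subgroup N :=
    { carrier := range (expMap N)
      mul_mem' := by
        rintro _ _ ⟨x, rfl⟩ ⟨y, rfl⟩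
        exact ⟨_, (expMap_mul hN x y).symm⟩
      one_mem' := ⟨0, expMap_zero⟩
      inv_mem' := by
        rintro _ ⟨x, rfl⟩
        exact ⟨-x, expMap_neg x⟩ }
  have hprod : ∀ (l : List _) t, expProd (Module.finBasis ℝ E) l t ∈ H := fun l t =>
    H.list_prod_mem (by simp only [List.mem_map]; rintro _ ⟨i, _, rfl⟩; exact ⟨_, rfl⟩)
  have hmem : (H : Set N) ∈ 𝓝 1 := by
    rw [← map_expProd_nhds (Module.finBasis ℝ E)]
    exact Filter.mem_map.mpr (univ_mem' fun t => hprod _ t)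
  have hopen : IsOpen (H : Set N) := H.isOpen_of_mem_nhds hmem
  have hclopen : IsClopen (H : Set N) := ⟨H.isClosed_of_isOpen hopen, hopen⟩
  have := hclopen.eq_univ ⟨1, H.one_mem⟩
  intro g
  exact (this ▸ mem_univ g : g ∈ (H : Set N))

/-- Conjugation by a central element is trivial, and `Ad (exp x) y = y + [x, y]` then kills the
bracket. Conversely, `exp x` commutes with every exponential, and these exhaust `N`. -/
theorem expMap_mem_center_iff [ConnectedSpace N] (hN : IsTwoStep E N) (x : E) :
    expMap N x ∈ Subgroup.center N ↔ x ∈ lieCenter E N := by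
  rw [mem_lieCenter_iff]
  constructor
  · intro h y
    have h1 : Ad N (expMap N x) y = Ad N 1 y := by
      unfold Ad
      congr 2
      ext v
      rw [← (Subgroup.mem_center_iff.mp h _)]
      simp
    rw [Ad_expMap hN, Ad_one_apply] at h1
    simpa using h1
  · intro h
    rw [Subgroup.mem_center_iff]
    intro g
    obtain ⟨y, rfl⟩ := surjective_expMap N hN g
    exact (commute_expMap (h y)).symm.eq

/-- A homomorphism to `ℝ` which is linear in exponential coordinates is continuous. -/
theorem continuous_of_expMap_linear (χ : N → ℝ) (hχ : ∀ g h, χ (g * h) = χ g + χ h)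
    (L : E →ₗ[ℝ] ℝ) (hL : ∀ x, χ (expMap N x) = L x) : Continuous χ := by
  have : IsTopologicalGroup N := topologicalGroup_of_lieGroup 𝓘(ℝ, E) ∞
  have h1 : χ 1 = 0 := by simpa using hχ 1 1
  let F : N →* Multiplicative ℝ :=
    { toFun := fun g => Multiplicative.ofAdd (χ g)
      map_one' := by rw [h1]; rfl
      map_mul' := fun g h => by rw [hχ]; rfl }
  have hF : ContinuousAt F 1 := by
    have h2 : Tendsto χ (𝓝 1) (𝓝 (χ 1)) := by
      -- In coordinates of the second kind `χ` is a linear function of the times.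
      rw [← map_expProd_nhds (N := N) (Module.finBasis ℝ E), tendsto_map'_iff, h1]
      have h3 : ∀ (l : List _) (t : _ → ℝ), χ (expProd (Module.finBasis ℝ E) l t) =
          (l.map fun i => t i * L (Module.finBasis ℝ E i)).sum := by
        intro l t
        induction l with
        | nil => simpa [expProd] using h1
        | cons i l ih =>
          have : χ (expProd (Module.finBasis ℝ E) (i :: l) t) =
            χ (expMap N (t i • Module.finBasis ℝ E i)) + χ (expProd (Module.finBasis ℝ E) l t) :=
              hχ _ _
          rw [this, hL, ih]; simp
      have h4 : Continuous (χ ∘ expProd (Module.finBasis ℝ E) Finset.univ.toList) := by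
        have : χ ∘ expProd (Module.finBasis ℝ E) Finset.univ.toList =
            fun t => ∑ i, t i * L (Module.finBasis ℝ E i) := by
          ext t; simp [h3]
        rw [this]
        fun_prop
      have := h4.tendsto 0
      simpa [expProd_zero, h1] using this
    exact h2
  exact continuous_of_continuousAt_one F hF

/-- On the center of the Lie algebra, the exponential map is a product of one-parameter
subgroups. -/
theorem expProd_eq_expMap_sum {ι : Type*} (X : ι → E) (hX : ∀ i, X i ∈ lieCenter E N)
    (l : List ι) (t : ι → ℝ) :
    expProd X l t = expMap N (l.map fun i => t i • X i).sum := by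
  induction l with
  | nil => simp [expProd]
  | cons i l ih =>
    have : (expProd X (i :: l) t : N) = expMap N (t i • X i) * expProd X l t := rfl
    rw [this, ih, List.map_cons, List.sum_cons, expMap_add_of_brL_eq_zero]
    simp [mem_lieCenter_iff.mp (hX i)]

theorem sum_repr_coe_finBasis {V : Type*} [AddCommGroup V] [Module ℝ V] [FiniteDimensional ℝ V]
    (W : Submodule ℝ V) (z : W) :
    ∑ i, (Module.finBasis ℝ W).repr z i • (Module.finBasis ℝ W i : V) = z := by
  conv_rhs => rw [← (Module.finBasis ℝ W).sum_repr z]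
  simp only [Submodule.coe_sum, Submodule.coe_smul]

/-- The exponential map on the center of the Lie algebra. -/
theorem expMap_center_eq (z : lieCenter E N) :
    expMap N (z : E) = expProd (fun i => (Module.finBasis ℝ (lieCenter E N) i : E))
      Finset.univ.toList ((Module.finBasis ℝ (lieCenter E N)).equivFun z) := by
  rw [expProd_eq_expMap_sum _ fun i => (Module.finBasis ℝ (lieCenter E N) i).2]
  congr 1
  rw [Finset.sum_map_toList]
  exact (sum_repr_coe_finBasis _ z).symm

/-- On `𝔷` the exponential is a finite product of one-parameter subgroups in linear coordinates, so
no smooth dependence of flows on parameters is needed. -/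
theorem contMDiffAt_expMap_center_zero :
    ContMDiffAt 𝓘(ℝ, lieCenter E N) 𝓘(ℝ, E) ∞ (fun z : lieCenter E N => expMap N (z : E)) 0 := by
  let T : lieCenter E N →L[ℝ] _ :=
    (Module.finBasis ℝ (lieCenter E N)).equivFun.toLinearMap.toContinuousLinearMap
  have h : (fun z : lieCenter E N => expMap N (z : E)) =
      expProd (fun i => (Module.finBasis ℝ (lieCenter E N) i : E)) Finset.univ.toList ∘ T :=
    funext expMap_center_eq
  rw [h]
  exact ContMDiffAt.comp_of_eq (contMDiffAt_expProd _ _) T.contDiff.contMDiff.contMDiffAt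
    (map_zero T)

theorem hasFDerivAt_expMap_center_zero :
    HasFDerivAt (fun z : lieCenter E N => chartAt E (1 : N) (expMap N (z : E)))
      (lieCenter E N).subtypeL 0 := by
  let T : lieCenter E N →L[ℝ] _ :=
    (Module.finBasis ℝ (lieCenter E N)).equivFun.toLinearMap.toContinuousLinearMap
  have h1 := hasFDerivAt_expProd_univ (N := N)
    (fun i => (Module.finBasis ℝ (lieCenter E N) i : E))
  rw [← map_zero T] at h1
  have h2 := h1.comp (0 : lieCenter E N) T.hasFDerivAt
  have h3 : (fun z : lieCenter E N => chartAt E (1 : N) (expMap N (z : E))) =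
      (fun t => chartAt E (1 : N) (expProd (fun i => (Module.finBasis ℝ (lieCenter E N) i : E))
        Finset.univ.toList t)) ∘ T :=
    funext fun z => congrArg (chartAt E (1 : N)) (expMap_center_eq z)
  rw [h3]
  refine h2.congr_fderiv ?_
  ext z
  simpa [T] using sum_repr_coe_finBasis _ z

theorem expMap_center_add (z : lieCenter E N) (w : E) :
    expMap N ((z : E) + w) = expMap N (z : E) * expMap N w :=
  expMap_add_of_brL_eq_zero (mem_lieCenter_iff.mp z.2 w)

/-- Additivity on `𝔷` moves any point to `0` by a left translation. -/
theorem contMDiff_expMap_center :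
    ContMDiff 𝓘(ℝ, lieCenter E N) 𝓘(ℝ, E) ∞ (fun z : lieCenter E N => expMap N (z : E)) := by
  intro z
  have h : (fun w : lieCenter E N => expMap N (w : E)) =
      fun w => expMap N (z : E) * expMap N ((w - z : lieCenter E N) : E) := by
    ext w
    rw [← expMap_center_add]; simp
  rw [h]
  refine contMDiffAt_const.mul ?_
  refine ContMDiffAt.comp_of_eq (f := fun w : lieCenter E N => w - z)
    contMDiffAt_expMap_center_zero ?_ (sub_self z)
  exact (contDiff_id.sub contDiff_const).contMDiff.contMDiffAt

end TwoStep

/-! ### Discrete subgroups of vector spaces -/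

section DiscreteSubgroups

open Filter Topology

theorem discreteTopology_of_eventually_eq_zero {V : Type*} [AddCommGroup V] [TopologicalSpace V]
    [IsTopologicalAddGroup V] (A : AddSubgroup V) (h : ∀ᶠ v in 𝓝 (0 : V), v ∈ A → v = 0) :
    DiscreteTopology A := by
  refine discreteTopology_of_isOpen_singleton_zero ?_
  rw [isOpen_singleton_iff_nhds_eq_pure, nhds_subtype_eq_comap]
  refine le_antisymm ?_ (by
    rw [← nhds_subtype_eq_comap]; exact pure_le_nhds _)
  rw [le_pure_iff, mem_comap]
  exact ⟨_, h, fun a ha => Subtype.ext (ha a.2)⟩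

/-- A discrete subgroup of a finite-dimensional real vector space has a `ℤ`-basis which is
linearly independent over `ℝ`. -/
theorem exists_basis_linearIndependent_of_discrete {V : Type*} [NormedAddCommGroup V]
    [NormedSpace ℝ V] [FiniteDimensional ℝ V] (L : Submodule ℤ V) [DiscreteTopology L] :
    ∃ (n : ℕ) (b : Module.Basis (Fin n) ℤ L), LinearIndependent ℝ (fun i => (b i : V)) := by
  refine ⟨_, Module.finBasis ℤ L, ?_⟩
  set b := Module.finBasis ℤ L
  have hspan : Submodule.span ℤ (Set.range fun i => (b i : V)) = L := by
    have : (Set.range fun i => (b i : V)) = L.subtype '' Set.range b := by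
      rw [← Set.range_comp]; rfl
    rw [this, ← Submodule.map_span, b.span_eq, Submodule.map_top, Submodule.range_subtype]
  rw [linearIndependent_iff_card_eq_finrank_span,
    Real.finrank_eq_int_finrank_of_discrete (by rw [hspan]; infer_instance), Set.finrank, hspan]
  simp

end DiscreteSubgroups

/-! ### The logarithm of a lattice -/

section Lattice

open Filter Topology Set

attribute [local instance] lieGroup_minSmoothness

variable {E : Type*} [NormedAddCommGroup E] [NormedSpace ℝ E]
  {N : Type*} [TopologicalSpace N] [ChartedSpace E N] [Group N]

/-- The character descends to the compact quotient, so it is bounded; but `χ (g ^ n) = n χ g` is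
unbounded unless `χ g = 0`. -/
theorem eq_zero_of_compactSpace_nilmanifold {Γ : Subgroup N} [CompactSpace (Nilmanifold Γ)]
    {χ : N → ℝ} (hχ : ∀ g h, χ (g * h) = χ g + χ h) (hc : Continuous χ)
    (hΓ : ∀ γ ∈ Γ, χ γ = 0) (g : N) : χ g = 0 := by
  let χ' : Nilmanifold Γ → ℝ := Quotient.lift χ (by
    rintro a b ⟨γ, rfl⟩
    change χ ((γ : N) * b) = χ b
    rw [hχ, hΓ γ γ.2, zero_add])
  have hc' : Continuous χ' := hc.quotient_lift _
  obtain ⟨C, hC⟩ := (isCompact_range hc').isBounded.exists_norm_le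
  have hC' : ∀ g, |χ g| ≤ C := fun g => hC _ ⟨Quotient.mk _ g, rfl⟩
  have h1 : χ 1 = 0 := by simpa using hχ 1 1
  have hpow : ∀ n : ℕ, χ (g ^ n) = n * χ g := fun n => by
    induction n with
    | zero => simpa using h1
    | succ n ih => rw [pow_succ, hχ, ih]; push_cast; ring
  by_contra hne
  obtain ⟨n, hn⟩ := exists_nat_gt (C / |χ g|)
  have h2 := hC' (g ^ n)
  rw [hpow, abs_mul, Nat.abs_cast] at h2
  rw [div_lt_iff₀ (abs_pos.mpr hne)] at hn
  linarith

variable [LieGroup 𝓘(ℝ, E) ∞ N] [FiniteDimensional ℝ E] [T2Space N]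

variable (E) in
/-- The set `log Γ`. -/
def logSet (Γ : Subgroup N) : Set E := {x | expMap N x ∈ Γ}

theorem mem_logSet {Γ : Subgroup N} {x : E} : x ∈ logSet E Γ ↔ expMap N x ∈ Γ := Iff.rfl

theorem zero_mem_logSet (Γ : Subgroup N) : (0 : E) ∈ logSet E Γ := by simp [mem_logSet]

theorem neg_mem_logSet {Γ : Subgroup N} {x : E} (hx : x ∈ logSet E Γ) : -x ∈ logSet E Γ := by
  rw [mem_logSet, expMap_neg]; exact Γ.inv_mem hx

theorem add_mem_logSet (hN : IsTwoStep E N) {Γ : Subgroup N} {x y : E} (hx : x ∈ logSet E Γ)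
    (hy : y ∈ logSet E Γ) : x + y + (1 / 2 : ℝ) • brL E N x y ∈ logSet E Γ := by
  rw [mem_logSet, ← expMap_mul hN]; exact Γ.mul_mem hx hy

/-- In a 2-step group `exp [x, y]` is the commutator `(exp y exp x)⁻¹ exp x exp y`. -/
theorem brL_mem_logSet (hN : IsTwoStep E N) {Γ : Subgroup N} {x y : E} (hx : x ∈ logSet E Γ)
    (hy : y ∈ logSet E Γ) : brL E N x y ∈ logSet E Γ := by
  have h := expMap_mul_expMap_swap hN y x
  rw [brL_swap x y, neg_neg] at h
  rw [mem_logSet, ← inv_mul_eq_iff_eq_mul.mpr h]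
  exact Γ.mul_mem (Γ.inv_mem (Γ.mul_mem hy hx)) (Γ.mul_mem hx hy)

theorem brL_mem_lieCenter (hN : IsTwoStep E N) (x y : E) : brL E N x y ∈ lieCenter E N :=
  mem_lieCenter_iff.mpr fun w => hN.brL_brL x y w

/-- The subgroup `log Γ ∩ 𝔷` of `𝔷`. -/
def logCenterSubgroup (Γ : Subgroup N) : AddSubgroup (lieCenter E N) where
  carrier := logCenter Γ
  zero_mem' := by
    change expMap N ((0 : lieCenter E N) : E) ∈ Γ
    rw [ZeroMemClass.coe_zero, expMap_zero]
    exact Γ.one_mem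
  add_mem' {x y} hx hy := by
    change expMap N ((x : E) + y) ∈ Γ
    rw [expMap_center_add]
    exact Γ.mul_mem hx hy
  neg_mem' {x} hx := by
    change expMap N (-(x : E)) ∈ Γ
    rw [expMap_neg]
    exact Γ.inv_mem hx

theorem mem_logCenterSubgroup {Γ : Subgroup N} {z : lieCenter E N} :
    z ∈ logCenterSubgroup Γ ↔ (z : E) ∈ logSet E Γ := Iff.rfl

/-- Near `0`, discreteness of `Γ` forces `exp z = 1`, and then `z = 0` because `exp` on `𝔷` has
injective derivative at `0`. -/
theorem eventually_mem_logCenterSubgroup_eq_zero (Γ : Subgroup N) [DiscreteTopology Γ] :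
    ∀ᶠ z in 𝓝 (0 : lieCenter E N), z ∈ logCenterSubgroup Γ → z = 0 := by
  have h1 : ∀ᶠ g in 𝓝 (1 : N), g ∈ Γ → g = 1 := by
    have h := (isOpen_discrete ({1} : Set Γ)).mem_nhds (mem_singleton 1)
    rw [nhds_subtype_eq_comap, mem_comap] at h
    obtain ⟨t, ht, hts⟩ := h
    filter_upwards [ht] with g hg hgΓ
    exact congrArg Subtype.val (hts (show (⟨g, hgΓ⟩ : Γ) ∈ _ from hg))
  have h2 : Tendsto (fun z : lieCenter E N => expMap N (z : E)) (𝓝 0) (𝓝 1) := by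
    have := (contMDiffAt_expMap_center_zero (E := E) (N := N)).continuousAt.tendsto
    simpa using this
  have h3 := (hasFDerivAt_expMap_center_zero (E := E) (N := N)).eventually_ne
    (c := chartAt E (1 : N) 1) ⟨1, AntilipschitzWith.subtype_coe _⟩
  rw [eventually_nhdsWithin_iff] at h3
  filter_upwards [h2.eventually h1, h3] with z hz1 hz2 hz
  by_contra hne
  exact hz2 hne (by rw [hz1 hz])

instance discreteTopology_logCenterSubgroup (Γ : Subgroup N) [DiscreteTopology Γ] :
    DiscreteTopology (logCenterSubgroup (E := E) Γ) :=
  discreteTopology_of_eventually_eq_zero _ (eventually_mem_logCenterSubgroup_eq_zero Γ)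

/-! ### Malcev's theorem: the lattice meets the center in a lattice -/

section Cocompact

variable [ConnectedSpace N] (hN : IsTwoStep E N) (Γ : Subgroup N) [CompactSpace (Nilmanifold Γ)]

include hN in
-- As `L` ignores brackets, the product formula makes `exp x ↦ L x` a homomorphism to `ℝ`; it is
-- continuous and trivial on `Γ`, so it vanishes.
theorem linear_eq_zero_of_logSet (L : E →ₗ[ℝ] ℝ) (hbr : ∀ x y, L (brL E N x y) = 0)
    (hΓ : ∀ x ∈ logSet E Γ, L x = 0) : L = 0 := by
  have hsurj := surjective_expMap N hN
  -- Injectivity of `exp` is avoided here: a logarithm of `exp x (exp y)⁻¹ = 1` lies in `log Γ`,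
  -- where `L` vanishes.
  have hker : ∀ x y, expMap N x = expMap N y → L x = L y := fun x y h => by
    have h1 := hΓ (x + -y + (1 / 2 : ℝ) • brL E N x (-y)) (by
      rw [mem_logSet, ← expMap_mul hN, expMap_neg, h, mul_inv_cancel]
      exact Γ.one_mem)
    simp only [map_add, map_smul, hbr, map_neg, neg_zero, smul_zero, add_zero] at h1
    linarith
  set χ : N → ℝ := fun g => L (Function.surjInv hsurj g) with hχdef
  have hχe : ∀ x, χ (expMap N x) = L x := fun x => hker _ _ (Function.surjInv_eq hsurj _)
  have hχ : ∀ g h, χ (g * h) = χ g + χ h := fun g h => by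
    obtain ⟨x, rfl⟩ := hsurj g
    obtain ⟨y, rfl⟩ := hsurj h
    rw [expMap_mul hN, hχe, hχe, hχe]
    simp [hbr]
  have hz := eq_zero_of_compactSpace_nilmanifold (Γ := Γ) hχ
    (continuous_of_expMap_linear χ hχ L hχe) (fun γ hγ => by
      obtain ⟨x, rfl⟩ := hsurj γ
      rw [hχe]; exact hΓ x hγ)
  ext x
  rw [← hχe, hz]; rfl

include hN in
/-- `log Γ` and the brackets together span the Lie algebra. -/
theorem eq_top_of_logSet_subset (T : Submodule ℝ E) (hbr : ∀ x y, brL E N x y ∈ T)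
    (hΓ : logSet E Γ ⊆ T) : T = ⊤ := by
  by_contra hT
  obtain ⟨L, hL0, hL⟩ := Submodule.exists_le_ker_of_lt_top T (lt_top_iff_ne_top.mpr hT)
  exact hL0 (linear_eq_zero_of_logSet hN Γ L (fun x y => hL (hbr x y)) fun x hx => hL (hΓ hx))

include hN in
-- The kernel of `ad x` contains `log Γ` by hypothesis and all brackets by 2-step nilpotency, so it
-- is everything.
theorem mem_lieCenter_of_logSet {x : E} (hx : ∀ y ∈ logSet E Γ, brL E N x y = 0) :
    x ∈ lieCenter E N := by
  have := eq_top_of_logSet_subset hN Γ (LinearMap.ker (brL E N x))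
    (fun y w => by rw [LinearMap.mem_ker, brL_swap, hN.brL_brL, neg_zero]) hx
  exact mem_lieCenter_iff.mpr fun y => LinearMap.mem_ker.mp (this ▸ Submodule.mem_top)

/-- The real span of `log Γ ∩ 𝔷`, in `𝔫`. -/
def spanLogCenter : Submodule ℝ E := Submodule.span ℝ (logSet E Γ ∩ lieCenter E N)

theorem spanLogCenter_le : spanLogCenter (E := E) Γ ≤ lieCenter E N :=
  Submodule.span_le.mpr inter_subset_right

include hN in
-- Brackets of elements of `log Γ` lie in `log Γ ∩ 𝔷`. The spanning property extends this to all of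
-- `𝔫`, one argument at a time.
theorem brL_mem_spanLogCenter (x y : E) : brL E N x y ∈ spanLogCenter Γ := by
  have key : ∀ u ∈ logSet E Γ, ∀ w, brL E N w u ∈ spanLogCenter Γ := fun u hu w => by
    have := eq_top_of_logSet_subset hN Γ ((spanLogCenter Γ).comap ((brL E N).flip u))
      (fun a b => by simp [hN.brL_brL])
      (fun v hv => Submodule.subset_span ⟨brL_mem_logSet hN hv hu, brL_mem_lieCenter hN v u⟩)
    have h : w ∈ (spanLogCenter Γ).comap ((brL E N).flip u) := this ▸ Submodule.mem_top
    exact h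
  have := eq_top_of_logSet_subset hN Γ ((spanLogCenter Γ).comap (brL E N x))
    (fun a b => by
      rw [Submodule.mem_comap, brL_swap, hN.brL_brL, neg_zero]; exact Submodule.zero_mem _)
    (fun v hv => key v hv x)
  have h : y ∈ (spanLogCenter Γ).comap (brL E N x) := this ▸ Submodule.mem_top
  exact h

include hN in
/-- The additive subgroup `log Γ + S`, where `S` is the span of `log Γ ∩ 𝔷`. -/
def logSetAddSpan : AddSubgroup E where
  carrier := {x | ∃ y ∈ logSet E Γ, x - y ∈ spanLogCenter Γ}
  zero_mem' := ⟨0, zero_mem_logSet Γ, by simp⟩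
  add_mem' := by
    rintro x x' ⟨y, hy, hxy⟩ ⟨y', hy', hxy'⟩
    -- The half bracket that keeps `log Γ` from being additive lies in `S`.
    refine ⟨_, add_mem_logSet hN hy hy', ?_⟩
    have : x + x' - (y + y' + (1 / 2 : ℝ) • brL E N y y') =
      (x - y) + (x' - y') - (1 / 2 : ℝ) • brL E N y y' := by abel
    rw [this]
    exact Submodule.sub_mem _ (Submodule.add_mem _ hxy hxy')
      (Submodule.smul_mem _ _ (brL_mem_spanLogCenter hN Γ y y'))
  neg_mem' := by
    rintro x ⟨y, hy, hxy⟩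
    refine ⟨-y, neg_mem_logSet hy, ?_⟩
    have : -x - -y = -(x - y) := by abel
    rw [this]
    exact Submodule.neg_mem _ hxy

theorem logSet_subset_logSetAddSpan : logSet E Γ ⊆ logSetAddSpan hN Γ :=
  fun x hx => ⟨x, hx, by simp⟩

/-- As `S ⊆ 𝔷`, the part of a central `x` coming from `log Γ` is itself central, so it lies in `log
Γ ∩ 𝔷`. -/
theorem mem_spanLogCenter_of_mem_logSetAddSpan {x : E} (hx : x ∈ logSetAddSpan hN Γ)
    (hz : x ∈ lieCenter E N) : x ∈ spanLogCenter Γ := by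
  obtain ⟨y, hy, hxy⟩ := hx
  have hyz : y ∈ lieCenter E N := by
    have := Submodule.sub_mem _ hz (spanLogCenter_le Γ hxy)
    simpa using this
  have := Submodule.add_mem _ hxy (Submodule.subset_span ⟨hy, hyz⟩ : y ∈ spanLogCenter Γ)
  simpa using this

include hN in
/-- Malcev: `log Γ ∩ 𝔷` spans `𝔷`. -/
theorem lieCenter_le_spanLogCenter [DiscreteTopology Γ] :
    lieCenter E N ≤ spanLogCenter Γ := by
  obtain ⟨s, hsΓ, hs⟩ := (Submodule.fg_span_iff_fg_span_finset_subset (R := ℝ) (logSet E Γ)).mp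
    (IsNoetherian.noetherian _)
  -- The finite set `s` spans the same space as `log Γ`, and `log Γ` detects the center, so `R` has
  -- kernel `𝔷`.
  let R : E →ₗ[ℝ] (s → lieCenter E N) := LinearMap.pi fun y =>
    ((brL E N).flip y).codRestrict (lieCenter E N) fun x => brL_mem_lieCenter hN x y
  have hRapp : ∀ x y, (R x y : E) = brL E N x y := fun _ _ => rfl
  have hRker : ∀ x, R x = 0 ↔ x ∈ lieCenter E N := fun x => by
    constructor
    · intro hx
      refine mem_lieCenter_of_logSet hN Γ fun y hy => ?_
      have hle : Submodule.span ℝ (s : Set E) ≤ LinearMap.ker (brL E N x) := by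
        rw [Submodule.span_le]
        intro u hu
        exact (hRapp x ⟨u, hu⟩).symm.trans (by rw [hx]; rfl)
      exact hle (hs ▸ Submodule.subset_span hy)
    · intro hx
      ext y
      exact mem_lieCenter_iff.mp hx y
  have hRS : ∀ x ∈ spanLogCenter Γ, R x = 0 := fun x hx => (hRker x).mpr (spanLogCenter_le Γ hx)
  -- Since `R` kills `S`, this group is just `R (log Γ)`. Its entries are brackets in the discrete
  -- group `log Γ ∩ 𝔷`, so it is discrete.
  let A : AddSubgroup (s → lieCenter E N) := (logSetAddSpan hN Γ).map R.toAddMonoidHom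
  have hA : ∀ a ∈ A, ∃ y ∈ logSet E Γ, R y = a := by
    rintro _ ⟨x, ⟨y, hy, hxy⟩, rfl⟩
    refine ⟨y, hy, ?_⟩
    have := hRS _ hxy
    rw [map_sub, sub_eq_zero] at this
    exact this.symm
  have hAd : DiscreteTopology A := by
    refine discreteTopology_of_eventually_eq_zero A ?_
    have h1 : ∀ y : s, ∀ᶠ v in 𝓝 (0 : s → lieCenter E N),
        v y ∈ logCenterSubgroup Γ → v y = 0 := fun y =>
      ((continuous_apply y).tendsto (0 : s → lieCenter E N)).eventually
        (eventually_mem_logCenterSubgroup_eq_zero Γ)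
    filter_upwards [eventually_all.mpr h1] with v hv hvA
    obtain ⟨x, hx, rfl⟩ := hA v hvA
    ext1 y
    exact hv y (mem_logCenterSubgroup.mpr (brL_mem_logSet hN hx (hsΓ y.2)))
  have hAd' : DiscreteTopology (AddSubgroup.toIntSubmodule A) := hAd
  obtain ⟨n, b, hb⟩ := exists_basis_linearIndependent_of_discrete (AddSubgroup.toIntSubmodule A)
  choose u huΓ hu using fun i => hA (b i) (b i).2
  -- Subtracting from `y ∈ log Γ` the integer combination of the `u i` with the same image under `R`
  -- leaves a central element of `log Γ + S`, hence an element of `S`.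
  have hT : spanLogCenter Γ ⊔ Submodule.span ℝ (range u) = ⊤ := by
    refine eq_top_of_logSet_subset hN Γ _
      (fun x y => Submodule.mem_sup_left (brL_mem_spanLogCenter hN Γ x y)) fun y hy => ?_
    have hyA : R y ∈ AddSubgroup.toIntSubmodule A :=
      ⟨y, logSet_subset_logSetAddSpan hN Γ hy, rfl⟩
    have hrep := congrArg Subtype.val (b.sum_repr ⟨R y, hyA⟩)
    set k := b.repr ⟨R y, hyA⟩
    have h1 : y - ∑ i, k i • u i ∈ logSetAddSpan hN Γ :=
      sub_mem (logSet_subset_logSetAddSpan hN Γ hy) (sum_mem fun i _ =>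
        zsmul_mem (logSet_subset_logSetAddSpan hN Γ (huΓ i)) _)
    have h2 : y - ∑ i, k i • u i ∈ lieCenter E N := by
      rw [← hRker, map_sub, map_sum, sub_eq_zero]
      refine hrep.symm.trans ?_
      simp [hu]
    have h3 := mem_spanLogCenter_of_mem_logSetAddSpan hN Γ h1 h2
    have h4 : ∑ i, k i • u i ∈ Submodule.span ℝ (range u) :=
      sum_mem fun i _ => zsmul_mem (Submodule.subset_span (mem_range_self i)) _
    have := Submodule.add_mem_sup h3 h4
    simpa using this
  intro z hz
  have hzT : z ∈ spanLogCenter Γ ⊔ Submodule.span ℝ (range u) := hT ▸ Submodule.mem_top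
  obtain ⟨v, hv, w, hw, rfl⟩ := Submodule.mem_sup.mp hzT
  obtain ⟨a, rfl⟩ := (Submodule.mem_span_range_iff_exists_fun ℝ).mp hw
  -- Applying `R` to `z = v + ∑ i, a i • u i` and using real independence of the `b i` gives `a =
  -- 0`, so `z = v ∈ S`.
  have h0 : ∑ i, a i • ((b i : A) : s → lieCenter E N) = 0 := by
    have h1 := (hRker _).mpr hz
    rw [map_add, hRS v hv, zero_add, map_sum] at h1
    simpa [hu] using h1
  have ha := Fintype.linearIndependent_iff.mp hb a h0
  simpa [ha] using hv

include hN in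
theorem span_logCenterSubgroup [DiscreteTopology Γ] :
    Submodule.span ℝ (logCenterSubgroup (E := E) Γ : Set (lieCenter E N)) = ⊤ := by
  refine (Submodule.map_injective_of_injective (lieCenter E N).injective_subtype) ?_
  rw [Submodule.map_span, Submodule.map_top, Submodule.range_subtype]
  refine le_antisymm ?_ ?_
  · rw [Submodule.span_le]
    rintro _ ⟨z, _, rfl⟩
    exact z.2
  · refine (lieCenter_le_spanLogCenter hN Γ).trans (Submodule.span_mono ?_)
    rintro x ⟨hx, hxz⟩
    exact ⟨⟨x, hxz⟩, hx, rfl⟩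

end Cocompact

end Lattice

/-! ### Smooth structures on covering quotients -/

section QuotientManifold

open Filter Topology Set

variable {F : Type*} [NormedAddCommGroup F] [NormedSpace ℝ F]
  {M : Type*} [TopologicalSpace M] [ChartedSpace F M]
  {M' : Type*} [TopologicalSpace M']

/-- The charts of `M'` are obtained from charts of `M` by composition with local inverses
of `π`. -/
def IsPushforwardAtlas [ChartedSpace F M'] (π : M → M') : Prop :=
  ∀ e ∈ atlas F M', ∃ s : OpenPartialHomeomorph M' M, ⇑s.symm = π ∧
    ∃ c ∈ atlas F M, e = s.trans c

/-- The fibers of `π` are homogeneous under the smooth deck transformations of `π`. -/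
def HasSmoothDeckTransformations (π : M → M') : Prop :=
  ∀ x y, π x = π y → ∃ φ : M → M, ContMDiff 𝓘(ℝ, F) 𝓘(ℝ, F) ∞ φ ∧ φ x = y ∧ ∀ z, π (φ z) = π z

theorem _root_.IsLocalHomeomorph.isPushforwardAtlas {π : M → M'} (hπ : IsLocalHomeomorph π)
    (hs : Function.Surjective π) :
    letI : ChartedSpace F M' := hπ.chartedSpace hs
    IsPushforwardAtlas (F := F) π := by
  rintro _ ⟨q, rfl⟩
  exact ⟨_, hπ.localInverseAt_symm _, _, chart_mem_atlas F _, rfl⟩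

/-- Near `x` the map `s ∘ π` coincides with the deck transformation taking `x` to `s (π x)`. All
smoothness statements about the quotient reduce to this. -/
theorem HasSmoothDeckTransformations.contMDiffAt_section_comp {π : M → M'}
    (hd : HasSmoothDeckTransformations (F := F) π)
    {s : OpenPartialHomeomorph M' M} (hs : ⇑s.symm = π) {x : M} (hx : π x ∈ s.source) :
    ContMDiffAt 𝓘(ℝ, F) 𝓘(ℝ, F) ∞ (fun y => s (π y)) x := by
  obtain ⟨φ, hφ, hφx, hφπ⟩ := hd x (s (π x)) (by
    have := s.left_inv hx
    rw [hs] at this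
    exact this.symm)
  refine (hφ x).congr_of_eventuallyEq ?_
  have ht : s.target ∈ 𝓝 (φ x) := by
    rw [hφx]
    exact s.open_target.mem_nhds (s.map_source hx)
  filter_upwards [hφ.continuous.continuousAt.preimage_mem_nhds ht] with y hy
  have := s.right_inv hy
  rw [hs, hφπ] at this
  exact this

variable [ChartedSpace F M']

/-- A transition map is `c' ∘ (s' ∘ π) ∘ c.symm`, with charts `c`, `c'` of `M` and a local section
`s'`. -/
theorem IsPushforwardAtlas.isManifold [IsManifold 𝓘(ℝ, F) ∞ M] {π : M → M'}
    (ha : IsPushforwardAtlas (F := F) π) (hd : HasSmoothDeckTransformations (F := F) π) :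
    IsManifold 𝓘(ℝ, F) ∞ M' := by
  refine isManifold_of_contDiffOn _ _ _ fun e e' he he' => ?_
  obtain ⟨s, hs, c, hc, rfl⟩ := ha e he
  obtain ⟨s', hs', c', hc', rfl⟩ := ha e' he'
  rintro y ⟨hy, -⟩
  refine ContDiffAt.contDiffWithinAt ?_
  rw [← contMDiffAt_iff_contDiffAt]
  have hy1 : y ∈ c.target := by
    have := hy.1
    exact this.1
  have hy2 : (s.trans c).symm y ∈ (s'.trans c').source := hy.2
  have hy3 : (s.trans c).symm y = π (c.symm y) := by rw [← hs]; rfl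
  rw [hy3] at hy2
  have h1 : ContMDiffAt 𝓘(ℝ, F) 𝓘(ℝ, F) ∞ c.symm y :=
    (contMDiffOn_symm_of_mem_maximalAtlas
      (IsManifold.subset_maximalAtlas hc)).contMDiffAt (c.open_target.mem_nhds hy1)
  have h2 := hd.contMDiffAt_section_comp hs' (x := c.symm y) hy2.1
  have h3 : ContMDiffAt 𝓘(ℝ, F) 𝓘(ℝ, F) ∞ c' (s' (π (c.symm y))) :=
    (contMDiffOn_of_mem_maximalAtlas
      (IsManifold.subset_maximalAtlas hc')).contMDiffAt (c'.open_source.mem_nhds hy2.2)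
  have h := h3.comp y (h2.comp y h1)
  have heq : (𝓘(ℝ, F) ∘ ((s.trans c).symm.trans (s'.trans c')) ∘ 𝓘(ℝ, F).symm)
      = (c' ∘ (fun y => s' (π y)) ∘ c.symm) := by
    rw [← hs]; rfl
  rw [heq]
  exact h

theorem IsPushforwardAtlas.contMDiff [IsManifold 𝓘(ℝ, F) ∞ M] {π : M → M'}
    (ha : IsPushforwardAtlas (F := F) π) (hd : HasSmoothDeckTransformations (F := F) π)
    (hc : Continuous π) : ContMDiff 𝓘(ℝ, F) 𝓘(ℝ, F) ∞ π := by
  intro x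
  rw [contMDiffAt_iff_target]
  refine ⟨hc.continuousAt, ?_⟩
  obtain ⟨s, hs, c, hcA, he⟩ := ha _ (chart_mem_atlas F (π x))
  have hx : π x ∈ (s.trans c).source := he ▸ mem_chart_source F (π x)
  have h3 : ContMDiffAt 𝓘(ℝ, F) 𝓘(ℝ, F) ∞ c (s (π x)) :=
    (contMDiffOn_of_mem_maximalAtlas
      (IsManifold.subset_maximalAtlas hcA)).contMDiffAt (c.open_source.mem_nhds hx.2)
  have h := h3.comp x (hd.contMDiffAt_section_comp hs hx.1)
  have heq : (extChartAt 𝓘(ℝ, F) (π x) ∘ π) = (c ∘ (fun y => s (π y))) := by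
    ext y
    simp [extChartAt, he]
  rw [heq]
  exact h

theorem IsPushforwardAtlas.contMDiffOn_section [IsManifold 𝓘(ℝ, F) ∞ M] {π : M → M'}
    (ha : IsPushforwardAtlas (F := F) π) (hd : HasSmoothDeckTransformations (F := F) π)
    {s : OpenPartialHomeomorph M' M} (hs : ⇑s.symm = π) :
    ContMDiffOn 𝓘(ℝ, F) 𝓘(ℝ, F) ∞ s s.source := by
  intro q hq
  refine ContMDiffAt.contMDiffWithinAt ?_
  rw [contMDiffAt_iff_source]
  obtain ⟨s₀, hs₀, c, hcA, he⟩ := ha _ (chart_mem_atlas F q)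
  have hq₀ : q ∈ (s₀.trans c).source := he ▸ mem_chart_source F q
  have heq : (s ∘ (extChartAt 𝓘(ℝ, F) q).symm) = ((fun y => s (π y)) ∘ c.symm) := by
    ext y
    simp [extChartAt, he, hs₀]
  have hval : extChartAt 𝓘(ℝ, F) q q = c (s₀ q) := by simp [extChartAt, he]
  rw [heq, hval]
  refine ContMDiffAt.contMDiffWithinAt ?_
  have hb : c.symm (c (s₀ q)) = s₀ q := c.left_inv hq₀.2
  have hπ : π (s₀ q) = q := by rw [← hs₀]; exact s₀.left_inv hq₀.1
  have h1 : ContMDiffAt 𝓘(ℝ, F) 𝓘(ℝ, F) ∞ c.symm (c (s₀ q)) :=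
    (contMDiffOn_symm_of_mem_maximalAtlas
      (IsManifold.subset_maximalAtlas hcA)).contMDiffAt
      (c.open_target.mem_nhds (c.map_source hq₀.2))
  refine ContMDiffAt.comp _ ?_ h1
  rw [hb]
  exact hd.contMDiffAt_section_comp hs (by rw [hπ]; exact hq)

theorem IsPushforwardAtlas.isLocalDiffeomorph [IsManifold 𝓘(ℝ, F) ∞ M] {π : M → M'}
    (ha : IsPushforwardAtlas (F := F) π) (hd : HasSmoothDeckTransformations (F := F) π)
    (hπ : IsLocalHomeomorph π) : IsLocalDiffeomorph 𝓘(ℝ, F) 𝓘(ℝ, F) ∞ π := by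
  intro x
  obtain ⟨t, hx, ht⟩ := hπ x
  refine ⟨{ t.toPartialEquiv with
    open_source := t.open_source
    open_target := t.open_target
    contMDiffOn_toFun := ?_
    contMDiffOn_invFun := ?_ }, hx, fun y _ => congrFun ht y⟩
  · have := (ha.contMDiff hd hπ.continuous).contMDiffOn (s := t.source)
    rw [ht] at this
    exact this
  · exact ha.contMDiffOn_section (F := F) hd (s := t.symm) (by rw [t.symm_symm]; exact ht.symm)

end QuotientManifold

/-! ### Pulling back and descending tensor fields -/

section Fields

variable {F : Type*} [NormedAddCommGroup F] [NormedSpace ℝ F]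
  {M : Type*} [TopologicalSpace M] [ChartedSpace F M]
  {F' : Type*} [NormedAddCommGroup F'] [NormedSpace ℝ F']
  {M' : Type*} [TopologicalSpace M'] [ChartedSpace F' M']
  {F'' : Type*} [NormedAddCommGroup F''] [NormedSpace ℝ F'']
  {M'' : Type*} [TopologicalSpace M''] [ChartedSpace F'' M'']

theorem pullbackField_apply (f : M → M') (h : BilinField F' M') (p : M)
    (X Y : TangentSpace 𝓘(ℝ, F) p) :
    pullbackField f h p X Y = h (f p) (mfderiv 𝓘(ℝ, F) 𝓘(ℝ, F') f p X)
      (mfderiv 𝓘(ℝ, F) 𝓘(ℝ, F') f p Y) := rfl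

theorem pullbackField_comp {g : M' → M''} {f : M → M'} (hg : MDifferentiable 𝓘(ℝ, F') 𝓘(ℝ, F'') g)
    (hf : MDifferentiable 𝓘(ℝ, F) 𝓘(ℝ, F') f) (h : BilinField F'' M'') :
    (pullbackField (g ∘ f) h : BilinField F M) =
      pullbackField f (pullbackField g h : BilinField F' M') := by
  funext p
  refine LinearMap.ext₂ fun X Y => ?_
  rw [pullbackField_apply, pullbackField_apply, pullbackField_apply,
    mfderiv_comp p (hg (f p)) (hf p)]
  rfl

/-- Each differential of `π` is invertible, so identities of tensors on a quotient may be checked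
upstairs. -/
theorem pullbackField_injective {π : M → M'} (hπ : IsLocalDiffeomorph 𝓘(ℝ, F) 𝓘(ℝ, F') ∞ π)
    (hs : Function.Surjective π) :
    Function.Injective (pullbackField π : BilinField F' M' → BilinField F M) := by
  intro h k hk
  funext q
  obtain ⟨p, rfl⟩ := hs q
  let L := (hπ p).mfderivToContinuousLinearEquiv (by simp)
  have hL : ∀ X, mfderiv 𝓘(ℝ, F) 𝓘(ℝ, F') π p X = L X := fun X => by
    rw [← (hπ p).mfderivToContinuousLinearEquiv_coe (by simp)]; rfl
  refine LinearMap.ext₂ fun X Y => ?_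
  have := congrArg (fun b => b (L.symm X) (L.symm Y)) (congrFun hk p)
  simp only [pullbackField_apply, hL, L.apply_symm_apply] at this
  exact this

/-- The chosen preimage of `π x` is `φ x` for a deck transformation `φ` preserving `g`.
Differentiating `π ∘ φ = π` identifies the change of base point with `dφ`, so the choice is
harmless. -/
theorem pullbackField_descendField {π : M → M'} (hπ : IsLocalDiffeomorph 𝓘(ℝ, F) 𝓘(ℝ, F') ∞ π)
    (hs : Function.Surjective π) {g : BilinField F M}
    (hg : ∀ x y, π x = π y → ∃ φ : M → M, MDifferentiable 𝓘(ℝ, F) 𝓘(ℝ, F) φ ∧ φ x = y ∧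
      (∀ z, π (φ z) = π z) ∧ pullbackField φ g = g) :
    pullbackField π (descendField (F' := F') π hs g) = g := by
  funext x
  obtain ⟨φ, hφ, hφx, hφπ, hφg⟩ := hg x (Function.surjInv hs (π x))
    (Function.surjInv_eq hs (π x)).symm
  -- The base point `y` is a variable because the chosen preimage equals `φ x` only propositionally.
  have key : ∀ y, y = φ x → ∀ X, (mfderiv 𝓘(ℝ, F) 𝓘(ℝ, F') π y : F →L[ℝ] F').inverse
      ((mfderiv 𝓘(ℝ, F) 𝓘(ℝ, F') π x : F →L[ℝ] F') X) =
      (mfderiv 𝓘(ℝ, F) 𝓘(ℝ, F) φ x : F →L[ℝ] F) X := by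
    rintro y rfl X
    have hc : mfderiv 𝓘(ℝ, F) 𝓘(ℝ, F') (π ∘ φ) x =
        (mfderiv 𝓘(ℝ, F) 𝓘(ℝ, F') π (φ x)).comp (mfderiv 𝓘(ℝ, F) 𝓘(ℝ, F) φ x) :=
      mfderiv_comp x ((hπ (φ x)).mdifferentiableAt (by simp)) (hφ x)
    have hc' : (mfderiv 𝓘(ℝ, F) 𝓘(ℝ, F') π x : F →L[ℝ] F') =
        (mfderiv 𝓘(ℝ, F) 𝓘(ℝ, F') π (φ x) : F →L[ℝ] F').comp
          (mfderiv 𝓘(ℝ, F) 𝓘(ℝ, F) φ x : F →L[ℝ] F) := by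
      have he : π ∘ φ = π := funext hφπ
      have : ∀ π', π' = π → (mfderiv 𝓘(ℝ, F) 𝓘(ℝ, F') π x : F →L[ℝ] F') =
          (mfderiv 𝓘(ℝ, F) 𝓘(ℝ, F') π' x : F →L[ℝ] F') := by
        rintro _ rfl; rfl
      exact (this _ he).trans hc
    let L : F ≃L[ℝ] F' := (hπ (φ x)).mfderivToContinuousLinearEquiv (by simp)
    have hL : (mfderiv 𝓘(ℝ, F) 𝓘(ℝ, F') π (φ x) : F →L[ℝ] F') = (L : F →L[ℝ] F') :=
      ((hπ (φ x)).mfderivToContinuousLinearEquiv_coe (by simp)).symm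
    have hi : (mfderiv 𝓘(ℝ, F) 𝓘(ℝ, F') π (φ x) : F →L[ℝ] F').inverse =
        (L.symm : F' →L[ℝ] F) := by
      refine (congrArg (fun A : F →L[ℝ] F' => A.inverse) hL).trans ?_
      exact ContinuousLinearMap.inverse_equiv L
    refine (congrArg (fun A : F' →L[ℝ] F => A _) hi).trans ?_
    refine (congrArg (fun A : F →L[ℝ] F' => L.symm (A X)) hc').trans ?_
    refine (congrArg (fun A : F →L[ℝ] F' => L.symm
      (A ((mfderiv 𝓘(ℝ, F) 𝓘(ℝ, F) φ x : F →L[ℝ] F) X))) hL).trans ?_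
    exact L.symm_apply_apply _
  refine LinearMap.ext₂ fun X Y => ?_
  have e1 : pullbackField π (descendField (F' := F') π hs g) x X Y =
      g (Function.surjInv hs (π x))
        ((mfderiv 𝓘(ℝ, F) 𝓘(ℝ, F) φ x : F →L[ℝ] F) X)
        ((mfderiv 𝓘(ℝ, F) 𝓘(ℝ, F) φ x : F →L[ℝ] F) Y) := by
    rw [← key _ hφx.symm, ← key _ hφx.symm]
    rfl
  have e2 : ∀ y, y = φ x → ∀ u v : F, g y u v = g (φ x) u v := by
    rintro y rfl u v; rfl
  rw [e1]
  refine (e2 _ hφx.symm _ _).trans ?_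
  exact congrArg (fun b => b X Y) (congrFun hφg x)

end Fields

/-! ### Injective differentials and immersions -/

section Immersion

open Filter Topology Set Module

/-- An injective linear map extends to a linear equivalence on the product with any space of
complementary dimension. -/
theorem exists_linearEquiv_coprod {F C E : Type*} [NormedAddCommGroup F] [NormedSpace ℝ F]
    [FiniteDimensional ℝ F] [NormedAddCommGroup C] [NormedSpace ℝ C] [FiniteDimensional ℝ C]
    [NormedAddCommGroup E] [NormedSpace ℝ E] [FiniteDimensional ℝ E]
    (hdim : finrank ℝ F + finrank ℝ C = finrank ℝ E) (A : F →L[ℝ] E)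
    (hA : Function.Injective A) :
    ∃ (ι : C →L[ℝ] E) (T : (F × C) ≃L[ℝ] E), ∀ p, T p = A p.1 + ι p.2 := by
  obtain ⟨W, hW⟩ := Submodule.exists_isCompl (LinearMap.range (A : F →ₗ[ℝ] E))
  have hr : finrank ℝ (LinearMap.range (A : F →ₗ[ℝ] E)) = finrank ℝ F :=
    LinearMap.finrank_range_of_inj hA
  have hc := Submodule.finrank_add_eq_of_isCompl hW
  let e : C ≃ₗ[ℝ] W := LinearEquiv.ofFinrankEq C W (by omega)
  let ι : C →ₗ[ℝ] E := W.subtype ∘ₗ e.toLinearMap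
  let T₀ : (F × C) →ₗ[ℝ] E := (A : F →ₗ[ℝ] E).coprod ι
  have hinj : Function.Injective T₀ := by
    rw [← LinearMap.ker_eq_bot, LinearMap.ker_eq_bot']
    rintro ⟨u, c⟩ h
    have h : A u + (e c : E) = 0 := h
    have h2 : A u = -(e c : E) := eq_neg_of_add_eq_zero_left h
    have h3 : A u ∈ W := h2 ▸ W.neg_mem (e c).2
    have h4 : A u = 0 := (Submodule.disjoint_def.mp hW.disjoint) _ ⟨u, rfl⟩ h3
    have h5 : e c = 0 := by
      rw [h4, zero_add] at h
      exact Subtype.ext h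
    have hu : u = 0 := hA (by rw [h4, map_zero])
    have hc : c = 0 := by simpa using h5
    rw [hu, hc]; rfl
  refine ⟨LinearMap.toContinuousLinearMap ι, (LinearEquiv.ofInjectiveOfFinrankEq T₀ hinj
    (by rw [finrank_prod, hdim])).toContinuousLinearEquiv, fun p => rfl⟩

variable {F : Type*} [NormedAddCommGroup F] [NormedSpace ℝ F] [FiniteDimensional ℝ F]
  {M : Type*} [TopologicalSpace M] [ChartedSpace F M] [IsManifold 𝓘(ℝ, F) ∞ M]
  {C : Type*} [NormedAddCommGroup C] [NormedSpace ℝ C] [FiniteDimensional ℝ C]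
  {E : Type*} [NormedAddCommGroup E] [NormedSpace ℝ E] [FiniteDimensional ℝ E]
  {M' : Type*} [TopologicalSpace M'] [ChartedSpace E M'] [IsManifold 𝓘(ℝ, E) ∞ M']

/-- Local normal form of a smooth map of vector spaces at a point where the derivative is
injective. -/
theorem exists_straightening (hdim : finrank ℝ F + finrank ℝ C = finrank ℝ E) {f : F → E}
    {U : Set F} (hU : IsOpen U) (hf : ContDiffOn ℝ ∞ f U) {u : F} (hu : u ∈ U)
    (hinj : Function.Injective (fderiv ℝ f u)) :
    ∃ (_ : (F × C) ≃L[ℝ] E) (G : OpenPartialHomeomorph (F × C) E),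
      (u, 0) ∈ G.source ∧ (∀ x, (x, 0) ∈ G.source → G (x, 0) = f x) ∧
      ContDiffOn ℝ ∞ G G.source ∧ ContDiffOn ℝ ∞ G.symm G.target := by
  have : CompleteSpace F := FiniteDimensional.complete ℝ F
  have : CompleteSpace C := FiniteDimensional.complete ℝ C
  obtain ⟨ι, T, hT⟩ := exists_linearEquiv_coprod (C := C) hdim (fderiv ℝ f u) hinj
  -- Thickening `f` by a complement of the image of its derivative makes the derivative at `(u, 0)`
  -- invertible.
  let Ψ : F × C → E := fun p => f p.1 + ι p.2
  let V : Set (F × C) := U ×ˢ univ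
  have hV : IsOpen V := hU.prod isOpen_univ
  have hΨ : ContDiffOn ℝ ∞ Ψ V :=
    (hf.comp contDiff_fst.contDiffOn fun p hp => hp.1).add
      (ι.contDiff.comp contDiff_snd).contDiffOn
  have huV : (u, (0 : C)) ∈ V := ⟨hu, mem_univ _⟩
  have hΨu : HasFDerivAt Ψ (T : F × C →L[ℝ] E) (u, 0) := by
    have h1 : HasFDerivAt f (fderiv ℝ f u) u :=
      ((hf.contDiffAt (hU.mem_nhds hu)).differentiableAt (by simp)).hasFDerivAt
    have h2 : HasFDerivAt Ψ ((fderiv ℝ f u).comp (ContinuousLinearMap.fst ℝ F C) +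
        ι.comp (ContinuousLinearMap.snd ℝ F C)) (u, 0) :=
      (HasFDerivAt.comp (u, (0 : C)) (f := Prod.fst) h1 hasFDerivAt_fst).add
        (HasFDerivAt.comp (u, (0 : C)) (f := Prod.snd) ι.hasFDerivAt hasFDerivAt_snd)
    refine h2.congr_fderiv ?_
    ext p <;> simp [hT]
  have hΨd : ContDiffAt ℝ ∞ Ψ (u, 0) := hΨ.contDiffAt (hV.mem_nhds huV)
  let G₀ := hΨd.toOpenPartialHomeomorph Ψ hΨu (by simp)
  -- Restricting to points of invertible derivative makes the inverse smooth on its whole domain,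
  -- not merely at one point.
  let R : Set (F × C →L[ℝ] E) := range ((↑) : ((F × C) ≃L[ℝ] E) → (F × C →L[ℝ] E))
  let W : Set (F × C) := V ∩ fderiv ℝ Ψ ⁻¹' R
  have hW : IsOpen W :=
    (hΨ.continuousOn_fderiv_of_isOpen hV (by simp)).isOpen_inter_preimage hV
      ContinuousLinearEquiv.isOpen
  let G := G₀.restrOpen W hW
  have hGs : ∀ p ∈ G.source, p ∈ W := fun p hp => hp.2
  refine ⟨T, G, ⟨hΨd.mem_toOpenPartialHomeomorph_source hΨu (by simp), huV, T, ?_⟩, ?_, ?_, ?_⟩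
  · exact hΨu.fderiv.symm
  · intro x _
    change f x + ι 0 = f x
    rw [map_zero, add_zero]
  · exact hΨ.mono fun p hp => (hGs p hp).1
  · intro y hy
    refine ContDiffAt.contDiffWithinAt ?_
    obtain ⟨hp1, T', hT'⟩ := hGs _ (G.map_target hy)
    have hd : ContDiffAt ℝ ∞ Ψ (G.symm y) := hΨ.contDiffAt (hV.mem_nhds hp1)
    have hf' : HasFDerivAt G (T' : F × C →L[ℝ] E) (G.symm y) := by
      rw [hT']
      exact (hd.differentiableAt (by simp)).hasFDerivAt
    exact G.contDiffAt_symm hy hf' hd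

/-- A smooth map between finite-dimensional manifolds with injective differential at `x` is an
immersion at `x`. -/
theorem isImmersionAtOfComplement_of_injective_mfderiv
    (hdim : finrank ℝ F + finrank ℝ C = finrank ℝ E) {f : M → M'}
    (hf : ContMDiff 𝓘(ℝ, F) 𝓘(ℝ, E) ∞ f) (x : M)
    (hinj : Function.Injective (mfderiv 𝓘(ℝ, F) 𝓘(ℝ, E) f x)) :
    Manifold.IsImmersionAtOfComplement C 𝓘(ℝ, F) 𝓘(ℝ, E) ∞ f x := by
  let φ := chartAt F x
  let ψ := chartAt E (f x)
  let U : Set F := φ.target ∩ φ.symm ⁻¹' (f ⁻¹' ψ.source)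
  have hU : IsOpen U := φ.isOpen_inter_preimage_symm (ψ.open_source.preimage hf.continuous)
  have hx : x ∈ φ.source := mem_chart_source F x
  have hfx : f x ∈ ψ.source := mem_chart_source E (f x)
  have hφx : φ.symm (φ x) = x := φ.left_inv hx
  have hu : φ x ∈ U := ⟨φ.map_source hx, by rw [mem_preimage, hφx]; exact hfx⟩
  have hφm : φ ∈ IsManifold.maximalAtlas 𝓘(ℝ, F) ∞ M := IsManifold.chart_mem_maximalAtlas x
  have hψm : ψ ∈ IsManifold.maximalAtlas 𝓘(ℝ, E) ∞ M' := IsManifold.chart_mem_maximalAtlas (f x)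
  have hloc : ContDiffOn ℝ ∞ (fun y => ψ (f (φ.symm y))) U := by
    rw [← contMDiffOn_iff_contDiffOn]
    exact (contMDiffOn_of_mem_maximalAtlas hψm).comp
      (hf.comp_contMDiffOn ((contMDiffOn_symm_of_mem_maximalAtlas hφm).mono
        inter_subset_left)) fun y hy => hy.2
  have hd : Function.Injective (fderiv ℝ (fun y => ψ (f (φ.symm y))) (φ x)) := by
    have h := ((hf x).mdifferentiableAt (by simp)).mfderiv
    have h2 : (mfderiv 𝓘(ℝ, F) 𝓘(ℝ, E) f x : F →L[ℝ] E) =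
        fderiv ℝ (fun y => ψ (f (φ.symm y))) (φ x) := by
      refine h.trans ?_
      simp only [modelWithCornersSelf_coe, range_id, fderivWithin_univ]
      rfl
    exact h2 ▸ hinj
  obtain ⟨T, G, hG0, hGf, hG1, hG2⟩ := exists_straightening (C := C) hdim hU hloc hu hd
  -- After `G.symm` the map reads `y ↦ (y, 0)`; `T` carries the product back to the model space `E`.
  let cod : OpenPartialHomeomorph M' E :=
    (ψ.trans G.symm).trans T.toHomeomorph.toOpenPartialHomeomorph
  let W : Set F := U ∩ (fun y => (y, (0 : C))) ⁻¹' G.source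
  have hW : IsOpen W := hU.inter (G.open_source.preimage (by fun_prop))
  let dom : OpenPartialHomeomorph M F := (φ.symm.restrOpen W hW).symm
  have hG0' : G (φ x, 0) = ψ (f x) := by rw [hGf _ hG0, hφx]
  refine Manifold.IsImmersionAtOfComplement.mk_of_continuousAt hf.continuous.continuousAt T dom cod
    ?_ ?_ ?_ ?_ ?_
  · refine ⟨hx, ?_⟩
    exact ⟨hu, hG0⟩
  · refine ⟨⟨hfx, ?_⟩, mem_univ _⟩
    change ψ (f x) ∈ G.target
    rw [← hG0']
    exact G.map_source hG0
  · rw [IsManifold.mem_maximalAtlas_iff_contMDiffOn]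
    exact ⟨(contMDiffOn_of_mem_maximalAtlas hφm).mono fun y hy => hy.1,
      (contMDiffOn_symm_of_mem_maximalAtlas hφm).mono fun y hy => hy.1⟩
  · rw [IsManifold.mem_maximalAtlas_iff_contMDiffOn]
    constructor
    · have h1 : ContMDiffOn 𝓘(ℝ, E) 𝓘(ℝ, E) ∞ (T ∘ G.symm) G.target :=
        contMDiffOn_iff_contDiffOn.mpr (T.contDiff.comp_contDiffOn hG2)
      exact h1.comp ((contMDiffOn_of_mem_maximalAtlas hψm).mono fun y hy => hy.1.1)
        fun y hy => hy.1.2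
    · have h1 : ContMDiffOn 𝓘(ℝ, E) 𝓘(ℝ, E) ∞ (G ∘ T.symm) (T.symm ⁻¹' G.source) :=
        contMDiffOn_iff_contDiffOn.mpr (hG1.comp T.symm.contDiff.contDiffOn fun y hy => hy)
      refine ((contMDiffOn_symm_of_mem_maximalAtlas hψm).comp
        (h1.mono fun y hy => hy.2.1) fun y hy => hy.2.2)
  · rintro y hy
    have hy' : y ∈ W := by
      have : y ∈ φ.target ∧ y ∈ W := by simpa [dom] using hy
      exact this.2
    change T (G.symm (ψ (f (φ.symm y)))) = T (y, 0)
    rw [← hGf y hy'.2, G.left_inv hy'.2]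

end Immersion

/-! ### Maps out of the base of a local diffeomorphism -/

section LocalDiffeo

open Filter Topology Set

variable {F : Type*} [NormedAddCommGroup F] [NormedSpace ℝ F]
  {M : Type*} [TopologicalSpace M] [ChartedSpace F M]
  {M₁ : Type*} [TopologicalSpace M₁] [ChartedSpace F M₁]
  {E : Type*} [NormedAddCommGroup E] [NormedSpace ℝ E]
  {M' : Type*} [TopologicalSpace M'] [ChartedSpace E M']

theorem contMDiff_of_comp_isLocalDiffeomorph {π : M → M₁}
    (hπ : IsLocalDiffeomorph 𝓘(ℝ, F) 𝓘(ℝ, F) ∞ π) (hs : Function.Surjective π) {f : M₁ → M'}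
    (hf : ContMDiff 𝓘(ℝ, F) 𝓘(ℝ, E) ∞ (f ∘ π)) : ContMDiff 𝓘(ℝ, F) 𝓘(ℝ, E) ∞ f := by
  intro q
  obtain ⟨x, rfl⟩ := hs q
  have h := (hf ((hπ x).localInverse (π x))).comp (π x) (hπ x).localInverse_contMDiffAt
  refine h.congr_of_eventuallyEq ?_
  filter_upwards [(hπ x).localInverse_eventuallyEq_right] with y hy
  exact (congrArg f hy).symm

theorem mfderiv_injective_of_comp_isLocalDiffeomorph {π : M → M₁}
    (hπ : IsLocalDiffeomorph 𝓘(ℝ, F) 𝓘(ℝ, F) ∞ π) {f : M₁ → M'}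
    (hf : MDifferentiable 𝓘(ℝ, F) 𝓘(ℝ, E) f) (x : M)
    (hinj : Function.Injective (mfderiv 𝓘(ℝ, F) 𝓘(ℝ, E) (f ∘ π) x)) :
    Function.Injective (mfderiv 𝓘(ℝ, F) 𝓘(ℝ, E) f (π x)) := by
  have hc := mfderiv_comp x (hf (π x)) ((hπ x).mdifferentiableAt (by simp))
  rw [hc] at hinj
  let L := (hπ x).mfderivToContinuousLinearEquiv (by simp)
  have hL : ∀ X, mfderiv 𝓘(ℝ, F) 𝓘(ℝ, F) π x X = L X := fun X => by
    rw [← (hπ x).mfderivToContinuousLinearEquiv_coe (by simp)]; rfl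
  intro X Y hXY
  have : L.symm X = L.symm Y := by
    apply hinj
    rw [ContinuousLinearMap.comp_apply, ContinuousLinearMap.comp_apply, hL, hL,
      L.apply_symm_apply, L.apply_symm_apply]
    exact hXY
  exact L.symm.injective this

end LocalDiffeo

/-! ### The flat torus -/

section TorusGeometry

variable {V : Type*} [NormedAddCommGroup V] [NormedSpace ℝ V] [FiniteDimensional ℝ V]
  (Λ : AddSubgroup V) [DiscreteTopology Λ]

theorem torusProj_eq_iff {Λ : AddSubgroup V} {v w : V} :
    torusProj Λ v = torusProj Λ w ↔ v - w ∈ Λ := by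
  refine Quotient.eq.trans ⟨?_, fun h => ⟨⟨v - w, h⟩, sub_add_cancel v w⟩⟩
  rintro ⟨l, rfl⟩
  have : (l : V) + w - w ∈ Λ := by rw [add_sub_cancel_right]; exact l.2
  exact this

theorem isLocalHomeomorph_torusProj : IsLocalHomeomorph (torusProj Λ) := by
  have : ProperSpace V := FiniteDimensional.proper ℝ V
  have : ProperlyDiscontinuousVAdd Λ V :=
    AddSubgroup.properlyDiscontinuousVAdd_of_tendsto_cofinite Λ
      (Λ.tendsto_coe_cofinite_of_discrete (isDiscrete_iff_discreteTopology.mpr inferInstance))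
  exact isAddQuotientCoveringMap_quotientMk_of_properlyDiscontinuousVAdd.isCoveringMap
    |>.isLocalHomeomorph

theorem isPushforwardAtlas_torusProj : IsPushforwardAtlas (F := V) (torusProj Λ) :=
  (isLocalHomeomorph_torusProj Λ).isPushforwardAtlas (torusProj_surjective Λ)

theorem hasSmoothDeckTransformations_torusProj :
    HasSmoothDeckTransformations (F := V) (torusProj Λ) := fun x y h =>
  ⟨fun v => (y - x) + v, (contDiff_const.add contDiff_id).contMDiff, by simp, fun z => by
    rw [torusProj_eq_iff, add_sub_cancel_right, ← neg_sub]
    exact Λ.neg_mem (torusProj_eq_iff.mp h)⟩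

instance isManifold_torus : IsManifold 𝓘(ℝ, V) ∞ (Torus Λ) :=
  (isPushforwardAtlas_torusProj Λ).isManifold (hasSmoothDeckTransformations_torusProj Λ)

theorem isLocalDiffeomorph_torusProj :
    IsLocalDiffeomorph 𝓘(ℝ, V) 𝓘(ℝ, V) ∞ (torusProj Λ) :=
  (isPushforwardAtlas_torusProj Λ).isLocalDiffeomorph (hasSmoothDeckTransformations_torusProj Λ)
    (isLocalHomeomorph_torusProj Λ)

theorem pullbackField_const_add (v : V) (b : LinearMap.BilinForm ℝ V) :
    pullbackField (F := V) (F' := V) (fun w : V => v + w) (fun _ => b) = fun _ => b := by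
  funext w
  have h : mfderiv 𝓘(ℝ, V) 𝓘(ℝ, V) (fun w : V => v + w) w = ContinuousLinearMap.id ℝ V :=
    ((hasFDerivAt_id w).const_add v).hasMFDerivAt.mfderiv
  refine LinearMap.ext₂ fun X Y => ?_
  exact congrArg (fun A : V →L[ℝ] V => b (A X) (A Y)) h

theorem pullbackField_torusMetric (b : LinearMap.BilinForm ℝ V) :
    pullbackField (torusProj Λ) (torusMetric Λ b) = fun _ : V => b :=
  pullbackField_descendField (isLocalDiffeomorph_torusProj Λ) _ fun x y h =>
    ⟨fun v => (y - x) + v, (contDiff_const.add contDiff_id).contMDiff.mdifferentiable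
      (n := ∞) (by simp), by simp, fun z => by
      rw [torusProj_eq_iff, add_sub_cancel_right, ← neg_sub]
      exact Λ.neg_mem (torusProj_eq_iff.mp h), pullbackField_const_add _ b⟩

/-- The projection is continuous and periodic under a full lattice, so its range is compact. -/
theorem compactSpace_torus (h : Submodule.span ℝ (Λ : Set V) = ⊤) : CompactSpace (Torus Λ) := by
  let L : Submodule ℤ V := AddSubgroup.toIntSubmodule Λ
  have hd : DiscreteTopology L := inferInstanceAs (DiscreteTopology Λ)
  have : IsZLattice ℝ L := ⟨h⟩
  have hc := IsZLattice.isCompact_range_of_periodic L (torusProj Λ)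
    (isLocalHomeomorph_torusProj Λ).continuous fun z w hw =>
      torusProj_eq_iff.mpr (by rw [add_sub_cancel_left]; exact hw)
  rw [(torusProj_surjective Λ).range_eq] at hc
  exact ⟨hc⟩

end TorusGeometry

/-! ### The nilmanifold and its metric -/

section NilmanifoldGeometry

variable {E : Type*} [NormedAddCommGroup E] [NormedSpace ℝ E] [FiniteDimensional ℝ E]
  {N : Type*} [TopologicalSpace N] [T2Space N] [ChartedSpace E N] [Group N]
  [LieGroup 𝓘(ℝ, E) ∞ N] (Γ : Subgroup N) [DiscreteTopology Γ]

theorem nilProj_eq_iff {Γ : Subgroup N} {x y : N} :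
    nilProj Γ x = nilProj Γ y ↔ x * y⁻¹ ∈ Γ := by
  refine Quotient.eq.trans ⟨?_, fun h => ⟨⟨x * y⁻¹, h⟩, inv_mul_cancel_right x y⟩⟩
  rintro ⟨l, rfl⟩
  have : (l : N) * y * y⁻¹ ∈ Γ := by rw [mul_inv_cancel_right]; exact l.2
  exact this

theorem nilProj_mul_left_eq {Γ : Subgroup N} {x y : N} (h : nilProj Γ x = nilProj Γ y) (z : N) :
    nilProj Γ (y * x⁻¹ * z) = nilProj Γ z := by
  rw [nilProj_eq_iff, mul_inv_cancel_right, ← nilProj_eq_iff, h]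

include E in
theorem isLocalHomeomorph_nilProj : IsLocalHomeomorph (nilProj Γ) := by
  have : IsTopologicalGroup N := topologicalGroup_of_lieGroup 𝓘(ℝ, E) ∞
  have : LocallyCompactSpace N := Manifold.locallyCompact_of_finiteDimensional 𝓘(ℝ, E)
  have : ProperlyDiscontinuousSMul Γ N :=
    Subgroup.properlyDiscontinuousSMul_of_tendsto_cofinite Γ
      (Γ.tendsto_coe_cofinite_of_discrete (isDiscrete_iff_discreteTopology.mpr inferInstance))
  exact isQuotientCoveringMap_quotientMk_of_properlyDiscontinuousSMul.isCoveringMap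
    |>.isLocalHomeomorph

include E in
theorem t2Space_nilmanifold : T2Space (Nilmanifold Γ) := by
  have : IsTopologicalGroup N := topologicalGroup_of_lieGroup 𝓘(ℝ, E) ∞
  have : LocallyCompactSpace N := Manifold.locallyCompact_of_finiteDimensional 𝓘(ℝ, E)
  have : ProperlyDiscontinuousSMul Γ N :=
    Subgroup.properlyDiscontinuousSMul_of_tendsto_cofinite Γ
      (Γ.tendsto_coe_cofinite_of_discrete (isDiscrete_iff_discreteTopology.mpr inferInstance))
  exact t2Space_of_properlyDiscontinuousSMul_of_t2Space

theorem isPushforwardAtlas_nilProj : IsPushforwardAtlas (F := E) (nilProj Γ) :=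
  (isLocalHomeomorph_nilProj (E := E) Γ).isPushforwardAtlas (nilProj_surjective Γ)

theorem hasSmoothDeckTransformations_nilProj :
    HasSmoothDeckTransformations (F := E) (nilProj Γ) := fun x y h =>
  ⟨fun n => (y * x⁻¹) * n, contMDiff_mul_left, by simp, fun z => nilProj_mul_left_eq h z⟩

instance isManifold_nilmanifold : IsManifold 𝓘(ℝ, E) ∞ (Nilmanifold Γ) :=
  (isPushforwardAtlas_nilProj Γ).isManifold (hasSmoothDeckTransformations_nilProj Γ)

theorem isLocalDiffeomorph_nilProj :
    IsLocalDiffeomorph 𝓘(ℝ, E) 𝓘(ℝ, E) ∞ (nilProj Γ) :=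
  (isPushforwardAtlas_nilProj Γ).isLocalDiffeomorph (hasSmoothDeckTransformations_nilProj Γ)
    (isLocalHomeomorph_nilProj (E := E) Γ)

theorem leftInvariantMetric_apply (B : LinearMap.BilinForm ℝ (LieAlg E N)) (p : N)
    (X Y : TangentSpace 𝓘(ℝ, E) p) :
    leftInvariantMetric B p X Y =
      (show E → E → ℝ from fun u v => B u v)
        ((mfderiv 𝓘(ℝ, E) 𝓘(ℝ, E) (fun n : N => p⁻¹ * n) p : E →L[ℝ] E) X)
        ((mfderiv 𝓘(ℝ, E) 𝓘(ℝ, E) (fun n : N => p⁻¹ * n) p : E →L[ℝ] E) Y) := rfl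

/-- Translating by `g` and then by `(g p)⁻¹` is translating by `p⁻¹`; apply the chain rule at `p`.
-/
theorem pullbackField_leftInvariantMetric (B : LinearMap.BilinForm ℝ (LieAlg E N)) (g : N) :
    pullbackField (F := E) (fun n : N => g * n) (leftInvariantMetric B) =
      leftInvariantMetric B := by
  funext p
  have h : (mfderiv 𝓘(ℝ, E) 𝓘(ℝ, E) (fun n : N => p⁻¹ * n) p : E →L[ℝ] E) =
      (mfderiv 𝓘(ℝ, E) 𝓘(ℝ, E) (fun n : N => (g * p)⁻¹ * n) (g * p) : E →L[ℝ] E).comp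
        (mfderiv 𝓘(ℝ, E) 𝓘(ℝ, E) (fun n : N => g * n) p : E →L[ℝ] E) := by
    have hc := mfderiv_comp (I := 𝓘(ℝ, E)) (I' := 𝓘(ℝ, E)) (I'' := 𝓘(ℝ, E)) p
      (mdifferentiableAt_mul_left (E := E) (g * p)⁻¹ (g * p))
      (mdifferentiableAt_mul_left (E := E) g p)
    have : ∀ φ : N → N, φ = (fun n : N => p⁻¹ * n) →
        (mfderiv 𝓘(ℝ, E) 𝓘(ℝ, E) (fun n : N => p⁻¹ * n) p : E →L[ℝ] E) =
        (mfderiv 𝓘(ℝ, E) 𝓘(ℝ, E) φ p : E →L[ℝ] E) := by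
      rintro _ rfl; rfl
    exact (this ((fun n => (g * p)⁻¹ * n) ∘ fun n => g * n)
      (by funext n; simp [mul_assoc])).trans hc
  refine LinearMap.ext₂ fun X Y => ?_
  rw [pullbackField_apply, leftInvariantMetric_apply, leftInvariantMetric_apply]
  exact (congrArg (fun A : E →L[ℝ] E => (show E → E → ℝ from fun u v => B u v) (A X) (A Y))
    h).symm

theorem pullbackField_nilMetric (B : LinearMap.BilinForm ℝ (LieAlg E N)) :
    pullbackField (nilProj Γ) (nilMetric Γ B) = leftInvariantMetric B :=
  pullbackField_descendField (isLocalDiffeomorph_nilProj Γ) _ fun x y h =>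
    ⟨fun n => (y * x⁻¹) * n, fun n => mdifferentiableAt_mul_left _ n, by simp,
      fun z => nilProj_mul_left_eq h z, pullbackField_leftInvariantMetric B _⟩

end NilmanifoldGeometry

/-! ### Orbits of the center and the fibers of the bundle -/

section Fiber

open Filter Topology Set

attribute [local instance] lieGroup_minSmoothness

variable {E : Type*} [NormedAddCommGroup E] [NormedSpace ℝ E] [FiniteDimensional ℝ E]
  {N : Type*} [TopologicalSpace N] [T2Space N] [ChartedSpace E N] [Group N]
  [LieGroup 𝓘(ℝ, E) ∞ N]

/-- The orbit map `v ↦ n exp v` of the center. -/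
def centerOrbit (E : Type*) [NormedAddCommGroup E] [NormedSpace ℝ E] [FiniteDimensional ℝ E]
    {N : Type*} [TopologicalSpace N] [T2Space N] [ChartedSpace E N] [Group N]
    [LieGroup 𝓘(ℝ, E) ∞ N] (n : N) (v : lieCenter E N) : N := n * expMap N (v : E)

theorem contMDiff_centerOrbit (n : N) :
    ContMDiff 𝓘(ℝ, lieCenter E N) 𝓘(ℝ, E) ∞ (centerOrbit E n) :=
  (contMDiff_mul_left (I := 𝓘(ℝ, E)) (a := n)).comp contMDiff_expMap_center

theorem inv_centerOrbit_mul (n : N) (v w : lieCenter E N) :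
    (centerOrbit E n v)⁻¹ * centerOrbit E n w = expMap N ((w - v : lieCenter E N) : E) := by
  have h : expMap N (w : E) = expMap N (v : E) * expMap N ((w - v : lieCenter E N) : E) := by
    rw [← expMap_center_add]; simp
  rw [centerOrbit, centerOrbit, h]
  group

/-- The composite is `w ↦ exp (w - v)`, independent of `n`. Both the isometry property and the
injectivity of the differential are read off from it. -/
theorem mfderiv_mul_left_comp_centerOrbit (n : N) (v : lieCenter E N) :
    (mfderiv 𝓘(ℝ, E) 𝓘(ℝ, E) (fun m : N => (centerOrbit E n v)⁻¹ * m)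
      (centerOrbit E n v) : E →L[ℝ] E).comp
      (mfderiv 𝓘(ℝ, lieCenter E N) 𝓘(ℝ, E) (centerOrbit E n) v : lieCenter E N →L[ℝ] E) =
      (lieCenter E N).subtypeL := by
  have hc := mfderiv_comp (I := 𝓘(ℝ, lieCenter E N)) (I' := 𝓘(ℝ, E)) (I'' := 𝓘(ℝ, E)) v
    (mdifferentiableAt_mul_left (E := E) (centerOrbit E n v)⁻¹ (centerOrbit E n v))
    ((contMDiff_centerOrbit n v).mdifferentiableAt (by simp))
  refine Eq.trans hc.symm ?_
  have he : (fun m : N => (centerOrbit E n v)⁻¹ * m) ∘ centerOrbit E n =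
      fun w : lieCenter E N => expMap N ((w - v : lieCenter E N) : E) :=
    funext fun w => inv_centerOrbit_mul n v w
  have hp : (fun w : lieCenter E N => expMap N ((w - v : lieCenter E N) : E)) v = 1 := by
    simp
  have hd : HasMFDerivAt 𝓘(ℝ, lieCenter E N) 𝓘(ℝ, E)
      ((fun m : N => (centerOrbit E n v)⁻¹ * m) ∘ centerOrbit E n) v
      (lieCenter E N).subtypeL := by
    rw [he]
    refine (hasMFDerivAt_iff_chartAt (A := (lieCenter E N).subtypeL) hp).mpr ⟨?_, ?_⟩
    · exact (contMDiff_expMap_center.continuous.comp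
        (continuous_id.sub continuous_const)).continuousAt
    · have h0 : HasFDerivAt (fun z : lieCenter E N => chartAt E (1 : N) (expMap N (z : E)))
          (lieCenter E N).subtypeL (v - v) := by
        rw [sub_self]; exact hasFDerivAt_expMap_center_zero
      exact HasFDerivAt.comp v (f := fun w => w - v) h0 ((hasFDerivAt_id v).sub_const v)
  exact hd.mfderiv

theorem pullbackField_centerOrbit (B : LinearMap.BilinForm ℝ (LieAlg E N)) (n : N) :
    pullbackField (F := lieCenter E N) (centerOrbit E n) (leftInvariantMetric B) =
      fun _ => centerForm B := by
  funext v
  refine LinearMap.ext₂ fun X Y => ?_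
  exact congrArg (fun A : lieCenter E N →L[ℝ] E =>
    (show E → E → ℝ from fun u v => B u v) (A X) (A Y)) (mfderiv_mul_left_comp_centerOrbit n v)

theorem injective_mfderiv_centerOrbit (n : N) (v : lieCenter E N) :
    Function.Injective (mfderiv 𝓘(ℝ, lieCenter E N) 𝓘(ℝ, E) (centerOrbit E n) v) := by
  intro X Y h
  have := congrArg (mfderiv 𝓘(ℝ, E) 𝓘(ℝ, E) (fun m : N => (centerOrbit E n v)⁻¹ * m)
    (centerOrbit E n v) : E →L[ℝ] E) h
  have hA := fun X : lieCenter E N => congrArg (fun A : lieCenter E N →L[ℝ] E => A X)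
    (mfderiv_mul_left_comp_centerOrbit n v)
  exact Subtype.ext (((hA X).symm.trans this).trans (hA Y))

variable [ConnectedSpace N]

theorem expMap_center_commute (hN : IsTwoStep E N) (v : lieCenter E N) (n : N) :
    n * expMap N (v : E) = expMap N (v : E) * n :=
  Subgroup.mem_center_iff.mp ((expMap_mem_center_iff hN _).mpr v.2) n

/-- Central factors move to the left of `n`, giving `n exp v = exp (v - w) (n exp w)`, so the two
points differ by the left factor `exp (v - w)`. -/
theorem nilProj_centerOrbit_eq_iff (hN : IsTwoStep E N) (Γ : Subgroup N) (n : N)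
    (v w : lieCenter E N) :
    nilProj Γ (centerOrbit E n v) = nilProj Γ (centerOrbit E n w) ↔
      v - w ∈ logCenterSubgroup Γ := by
  have h : centerOrbit E n v = expMap N ((v - w : lieCenter E N) : E) * centerOrbit E n w := by
    have hv : expMap N (v : E) = expMap N ((v - w : lieCenter E N) : E) * expMap N (w : E) := by
      rw [← expMap_center_add]; simp
    rw [centerOrbit, centerOrbit, expMap_center_commute hN v, hv, mul_assoc,
      expMap_center_commute hN w]
  rw [nilProj_eq_iff, h, mul_inv_cancel_right]
  rfl

/-- A fiber of `projB` is an orbit of `Z`, and `Z = exp 𝔷`. -/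
theorem range_nilProj_centerOrbit (hN : IsTwoStep E N) (Γ : Subgroup N) (n : N) :
    range (fun v : lieCenter E N => nilProj Γ (centerOrbit E n v)) =
      projB Γ ⁻¹' {projB Γ (nilProj Γ n)} := by
  ext q
  have hq : q ∈ projB Γ ⁻¹' {projB Γ (nilProj Γ n)} ↔
      ∃ z : Subgroup.center N, z • nilProj Γ n = q := Quotient.eq
  rw [hq]
  constructor
  · rintro ⟨v, rfl⟩
    refine ⟨⟨expMap N (v : E), (expMap_mem_center_iff hN _).mpr v.2⟩, ?_⟩
    exact congrArg (nilProj Γ) (expMap_center_commute hN v n).symm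
  · rintro ⟨⟨z, hz⟩, rfl⟩
    obtain ⟨x, rfl⟩ := surjective_expMap N hN z
    refine ⟨⟨x, (expMap_mem_center_iff hN x).mp hz⟩, ?_⟩
    exact congrArg (nilProj Γ) (expMap_center_commute hN ⟨x, (expMap_mem_center_iff hN x).mp hz⟩ n)

/-- The map `𝔷 / (log Γ ∩ 𝔷) → Γ \ N` induced by `v ↦ Γ n exp v`. -/
def fiberMap (hN : IsTwoStep E N) (Γ : Subgroup N) (n : N) :
    Torus (logCenterSubgroup (E := E) Γ) → Nilmanifold Γ :=
  Quotient.lift (fun v => nilProj Γ (centerOrbit E n v)) fun v w h =>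
    (nilProj_centerOrbit_eq_iff hN Γ n v w).mpr (torusProj_eq_iff.mp (Quotient.sound h))

theorem fiberMap_comp_torusProj (hN : IsTwoStep E N) (Γ : Subgroup N) (n : N) :
    fiberMap hN Γ n ∘ torusProj (logCenterSubgroup Γ) = nilProj Γ ∘ centerOrbit E n := rfl

theorem injective_fiberMap (hN : IsTwoStep E N) (Γ : Subgroup N) (n : N) :
    Function.Injective (fiberMap hN Γ n) := by
  intro p q h
  obtain ⟨v, rfl⟩ := torusProj_surjective _ p
  obtain ⟨w, rfl⟩ := torusProj_surjective _ q
  exact torusProj_eq_iff.mpr ((nilProj_centerOrbit_eq_iff hN Γ n v w).mp h)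

variable (Γ : Subgroup N) [DiscreteTopology Γ]

theorem contMDiff_nilProj_comp_centerOrbit (n : N) :
    ContMDiff 𝓘(ℝ, lieCenter E N) 𝓘(ℝ, E) ∞ (nilProj Γ ∘ centerOrbit E n) :=
  (isLocalDiffeomorph_nilProj Γ).contMDiff.comp (contMDiff_centerOrbit n)

theorem contMDiff_fiberMap (hN : IsTwoStep E N) (n : N) :
    ContMDiff 𝓘(ℝ, lieCenter E N) 𝓘(ℝ, E) ∞ (fiberMap hN Γ n) :=
  contMDiff_of_comp_isLocalDiffeomorph (isLocalDiffeomorph_torusProj _) (torusProj_surjective _)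
    (contMDiff_nilProj_comp_centerOrbit Γ n)

theorem injective_mfderiv_fiberMap (hN : IsTwoStep E N) (n : N)
    (p : Torus (logCenterSubgroup (E := E) Γ)) :
    Function.Injective (mfderiv 𝓘(ℝ, lieCenter E N) 𝓘(ℝ, E) (fiberMap hN Γ n) p) := by
  obtain ⟨v, rfl⟩ := torusProj_surjective _ p
  refine mfderiv_injective_of_comp_isLocalDiffeomorph (isLocalDiffeomorph_torusProj _)
    ((contMDiff_fiberMap Γ hN n).mdifferentiable (by simp)) v ?_
  have hc : mfderiv 𝓘(ℝ, lieCenter E N) 𝓘(ℝ, E) (nilProj Γ ∘ centerOrbit E n) v = _ :=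
    mfderiv_comp v ((isLocalDiffeomorph_nilProj Γ _).mdifferentiableAt (by simp))
      ((contMDiff_centerOrbit n v).mdifferentiableAt (by simp))
  have hi : Function.Injective
      (mfderiv 𝓘(ℝ, lieCenter E N) 𝓘(ℝ, E) (nilProj Γ ∘ centerOrbit E n) v) := by
    rw [hc, ContinuousLinearMap.coe_comp]
    refine Function.Injective.comp ?_ (injective_mfderiv_centerOrbit n v)
    rw [← (isLocalDiffeomorph_nilProj Γ _).mfderivToContinuousLinearEquiv_coe (by simp)]
    exact ((isLocalDiffeomorph_nilProj Γ _).mfderivToContinuousLinearEquiv (by simp)).injective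
  exact hi

/-- Pulled back once more to `𝔷`, both sides become the constant tensor `centerForm B`. -/
theorem pullbackField_fiberMap (hN : IsTwoStep E N) (n : N)
    (B : LinearMap.BilinForm ℝ (LieAlg E N)) :
    pullbackField (fiberMap hN Γ n) (nilMetric Γ B) =
      torusMetric (logCenterSubgroup Γ) (centerForm B) := by
  refine pullbackField_injective (isLocalDiffeomorph_torusProj (logCenterSubgroup (E := E) Γ))
    (torusProj_surjective _) ?_
  rw [pullbackField_torusMetric, ← pullbackField_comp
    ((contMDiff_fiberMap Γ hN n).mdifferentiable (by simp))
    ((isLocalDiffeomorph_torusProj _).mdifferentiable (by simp)), fiberMap_comp_torusProj,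
    pullbackField_comp ((isLocalDiffeomorph_nilProj Γ).mdifferentiable (by simp))
    ((contMDiff_centerOrbit n).mdifferentiable (by simp)), pullbackField_nilMetric,
    pullbackField_centerOrbit]

theorem isImmersion_fiberMap (hN : IsTwoStep E N) (n : N) :
    Manifold.IsImmersion 𝓘(ℝ, lieCenter E N) 𝓘(ℝ, E) ∞ (fiberMap hN Γ n) := by
  obtain ⟨C, hC⟩ := Submodule.exists_isCompl (lieCenter E N)
  exact ⟨C, inferInstance, inferInstance, fun p =>
    isImmersionAtOfComplement_of_injective_mfderiv (Submodule.finrank_add_eq_of_isCompl hC)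
      (contMDiff_fiberMap Γ hN n) p (injective_mfderiv_fiberMap Γ hN n p)⟩

theorem isIsometryOnto_fiberMap (hN : IsTwoStep E N) [CompactSpace (Nilmanifold Γ)] (n : N)
    (B : LinearMap.BilinForm ℝ (LieAlg E N)) :
    IsIsometryOnto (torusMetric (logCenterSubgroup Γ) (centerForm B)) (nilMetric Γ B)
      (fiberMap hN Γ n) (projB Γ ⁻¹' {projB Γ (nilProj Γ n)}) where
  isSmoothEmbedding := by
    -- Malcev's theorem enters here: it makes the torus compact, so the injective continuous map
    -- into a Hausdorff space is a closed embedding.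
    have := compactSpace_torus (logCenterSubgroup (E := E) Γ) (span_logCenterSubgroup hN Γ)
    have := t2Space_nilmanifold (E := E) Γ
    exact ⟨isImmersion_fiberMap Γ hN n,
      ((contMDiff_fiberMap Γ hN n).continuous.isClosedEmbedding
        (injective_fiberMap hN Γ n)).isEmbedding⟩
  range_eq := by
    rw [← range_nilProj_centerOrbit (E := E) hN Γ n]
    exact ((torusProj_surjective _).range_comp (fiberMap hN Γ n)).symm
  isometric := pullbackField_fiberMap Γ hN n B

end Fiber

end Nil

end

/-! ### The theorem -/

theorem mainTheorem9
    {E : Type*} [NormedAddCommGroup E] [NormedSpace ℝ E] [FiniteDimensional ℝ E]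
    {N : Type*} [TopologicalSpace N] [T2Space N] [ChartedSpace E N] [Group N]
    [LieGroup 𝓘(ℝ, E) ∞ N] [SimplyConnectedSpace N] (hN : Nil.IsTwoStep E N)
    (B : LinearMap.BilinForm ℝ (Nil.LieAlg E N)) (hBsymm : B.IsSymm) (hBnd : B.Nondegenerate)
    (Γ : Subgroup N) [DiscreteTopology Γ] [CompactSpace (Nil.Nilmanifold Γ)] :
    ∃ (Λ : AddSubgroup (Nil.lieCenter E N)) (_ : DiscreteTopology Λ),
      (Λ : Set (Nil.lieCenter E N)) = Nil.logCenter Γ ∧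
      Submodule.span ℝ (Λ : Set (Nil.lieCenter E N)) = ⊤ ∧
      ∀ b : Nil.TB Γ, ∃ f : Nil.Torus Λ → Nil.Nilmanifold Γ,
        Nil.IsIsometryOnto (Nil.torusMetric Λ (Nil.centerForm B)) (Nil.nilMetric Γ B) f
          (Nil.projB Γ ⁻¹' {b}) := by
  refine ⟨Nil.logCenterSubgroup Γ, inferInstance, rfl, Nil.span_logCenterSubgroup hN Γ,
    fun b => ?_⟩
  -- Any `n : N` above `b` serves as base point of the isometry.
  obtain ⟨q, rfl⟩ := Quotient.mk_surjective b
  obtain ⟨n, rfl⟩ := Nil.nilProj_surjective Γ q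
  exact ⟨Nil.fiberMap hN Γ n, Nil.isIsometryOnto_fiberMap Γ hN n B⟩
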